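/- Let $\Bbbk$ be a field of characteristic different from $2$, and let $\mathcal{Q}\mathit{Sym}$ be the graded connected Hopf algebra of quasi-symmetric functions over $\Bbbk$ (the quasi-symmetric formal power series of bounded degree in $x_0,x_1,x_2,\dots$), with monomial basis $M_{(a_1,\dots,a_k)}=\sum_{i_1<\dots<i_k}x_{i_1}^{a_1}\cdots x_{i_k}^{a_k}$, coproduct $\Delta(M_{(a_1,\dots,a_k)})=\sum_{i=0}^k M_{(a_1,\dots,a_i)}\otimes M_{(a_{i+1},\dots,a_k)}$, and fundamental basis $F_\alpha=\sum_{\beta}M_\beta$, where $\beta$ runs over the compositions of $n$ that refine the composition $\alpha$ of $n$. Linear functionals on $\mathcal{Q}\mathit{Sym}$ are multiplied by convolution, with the counit as unit. For a functional $\varphi$, let $\bar\varphi(h)=(-1)^n\varphi(h)$ for $h$ homogeneous of degree $n$; $\varphi$ is even if $\bar\varphi=\varphi$, and odd if it is invertible for convolution and $\bar\varphi=\varphi^{-1}$. If $\varphi(1)=1$, its even part $\varphi_+$ and odd part $\varphi_-$ are the unique linear functionals with $\varphi_+(1)=\varphi_-(1)=1$, $\varphi_+$ even, $\varphi_-$ odd,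 and $\varphi=\varphi_+\varphi_-$. Let $\zeta$ be the universal character, the specialization of one variable ($x_0$) to $1$ and of all other variables to $0$. For a composition $\alpha=(a_1,\dots,a_k)$ of a non-negative integer $n$ let $\tilde\alpha=(a_k,\dots,a_1)$ be its reversal and let $\alpha'$ be its conjugate (the composition of $n$ whose partial sums strictly between $0$ and $n$ are the numbers $n-i$, where $0<i<n$ and $i$ is not a partial sum of $\alpha$; equivalently, its ribbon diagram is the reflection of that of $\alpha$ across $y=x$). Put $p_-(\alpha)=\#\{i\neq k: a_i>1\}$, and $p_+(\alpha)=1+\#\{i\neq 1,k: a_i>1\}$ if $k>1$, $p_+(\alpha)=0$ if $k\le 1$. Let $$C(m,n)=\frac{(2m)!\,(2n)!}{m!\,(m+n)!\,n!}$$ be the bivariate Catalan numbers, which are integers. Theorem. The functional $\zeta$ is invertible for convolution, and $\zeta^{-1}$ has a unique even part $(\zeta^{-1})_+$ and odd part $(\zeta^{-1})_-$. For every composition $\alpha$ of a non-negative integer $n$, $$(\zeta^{-1})_-(F_\alpha)=\frac{(-1)^{n+p_-(\tilde\alpha)}}{2^{2\lfloor n/2\rfloor}}\,C\bigl(p_-(\tilde\alpha),\lfloor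 n/2\rfloor-p_-(\tilde\alpha)\bigr),$$ $$(\zeta^{-1})_+(F_\alpha)=\begin{cases}\dfrac{(-1)^{p_+(\alpha')}}{2^{n}}\,C\bigl(p_+(\alpha'),n/2-p_+(\alpha')\bigr)&\text{if $n$ is even,}\\[2mm] 0&\text{if $n$ is odd.}\end{cases}$$ -/

import Mathlib

open scoped TensorProduct

namespace QuasiSym

/-! ### Quasi-symmetric functions as formal power series in `x₀, x₁, x₂, …` -/

section Basic

variable {k : Type*} [Field k]

/-- The coefficients of `x_{i_1}^{a_1} ⋯ x_{i_m}^{a_m}` and `x_{j_1}^{a_1} ⋯ x_{j_m}^{a_m}` agree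
whenever `i_1 < ⋯ < i_m` and `j_1 < ⋯ < j_m`. -/
def IsQuasiSymmetric (f : MvPowerSeries ℕ k) : Prop :=
  ∀ (m : ℕ) (a : Fin m →₀ ℕ) (i j : Fin m ↪o ℕ),
    MvPowerSeries.coeff (a.embDomain i.toEmbedding) f =
      MvPowerSeries.coeff (a.embDomain j.toEmbedding) f

/-- The total degrees of the monomials that occur in `f` are bounded. -/
def HasBoundedDegree (f : MvPowerSeries ℕ k) : Prop :=
  ∃ N : ℕ, ∀ d : ℕ →₀ ℕ, MvPowerSeries.coeff d f ≠ 0 → d.degree ≤ N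

theorem IsQuasiSymmetric.mul {f g : MvPowerSeries ℕ k} (hf : IsQuasiSymmetric f)
    (hg : IsQuasiSymmetric g) : IsQuasiSymmetric (f * g) := by
  classical
  intro m a i j
  have key : ∀ i : Fin m ↪o ℕ, MvPowerSeries.coeff (a.embDomain i.toEmbedding) (f * g) =
      ∑ p ∈ Finset.HasAntidiagonal.antidiagonal a, MvPowerSeries.coeff (p.1.embDomain i.toEmbedding) f *
        MvPowerSeries.coeff (p.2.embDomain i.toEmbedding) g := by
    intro i
    rw [MvPowerSeries.coeff_mul, ← Finsupp.image_prodMap_embDomain_antidiagonal,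
      Finset.sum_image]
    · rfl
    · exact (Function.Injective.prodMap (Finsupp.embDomain_injective _)
        (Finsupp.embDomain_injective _)).injOn
  rw [key i, key j]
  exact Finset.sum_congr rfl fun p _ => by rw [hf m p.1 i j, hg m p.2 i j]

theorem HasBoundedDegree.mul {f g : MvPowerSeries ℕ k} (hf : HasBoundedDegree f)
    (hg : HasBoundedDegree g) : HasBoundedDegree (f * g) := by
  classical
  obtain ⟨N, hN⟩ := hf
  obtain ⟨N', hN'⟩ := hg
  refine ⟨N + N', fun d hd => ?_⟩
  rw [MvPowerSeries.coeff_mul] at hd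
  obtain ⟨p, hp, hne⟩ := Finset.exists_ne_zero_of_sum_ne_zero hd
  rw [Finset.HasAntidiagonal.mem_antidiagonal] at hp
  have h1 := hN p.1 (left_ne_zero_of_mul hne)
  have h2 := hN' p.2 (right_ne_zero_of_mul hne)
  rw [← hp, map_add]
  exact add_le_add h1 h2

end Basic

/-- The algebra of quasi-symmetric functions over `k`. -/
def QSym (k : Type*) [Field k] : Subalgebra k (MvPowerSeries ℕ k) where
  carrier := {f | IsQuasiSymmetric f ∧ HasBoundedDegree f}
  mul_mem' hf hg := ⟨hf.1.mul hg.1, hf.2.mul hg.2⟩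
  add_mem' {f g} hf hg := by
    refine ⟨fun m a i j => ?_, ?_⟩
    · rw [map_add, map_add, hf.1 m a i j, hg.1 m a i j]
    · obtain ⟨N, hN⟩ := hf.2
      obtain ⟨N', hN'⟩ := hg.2
      refine ⟨max N N', fun d hd => ?_⟩
      by_cases h : MvPowerSeries.coeff d f = 0
      · refine (hN' d fun h' => hd ?_).trans (le_max_right _ _)
        rw [map_add, h, h', add_zero]
      · exact (hN d h).trans (le_max_left _ _)
  algebraMap_mem' r := by
    classical
    have hz : ∀ (m : ℕ) (a : Fin m →₀ ℕ) (i : Fin m ↪o ℕ),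
        a.embDomain i.toEmbedding = 0 ↔ a = 0 := by
      intro m a i
      rw [← Finsupp.embDomain_zero i.toEmbedding]
      exact (Finsupp.embDomain_injective i.toEmbedding).eq_iff
    refine ⟨fun m a i j => ?_, 0, fun d hd => ?_⟩
    · simp only [MvPowerSeries.algebraMap_apply, MvPowerSeries.coeff_C, hz]
    · rw [MvPowerSeries.algebraMap_apply, MvPowerSeries.coeff_C] at hd
      have : d = 0 := by
        by_contra h
        simp [h] at hd
      simp [this]

/-! ### The monomial basis -/

/-- The exponent list `(a_1, …, a_m)` of a monomial `x_{i_1}^{a_1} ⋯ x_{i_m}^{a_m}` with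
`i_1 < ⋯ < i_m` and all `a_j` positive. -/
def expList (d : ℕ →₀ ℕ) : List ℕ := (d.support.sort (· ≤ ·)).map d

theorem expList_embDomain {m : ℕ} (a : Fin m →₀ ℕ) (i : Fin m ↪o ℕ) :
    expList (a.embDomain i.toEmbedding) = (a.support.sort (· ≤ ·)).map a := by
  unfold expList
  rw [Finsupp.support_embDomain,
    ← Finset.map_sort i.toEmbedding a.support (· ≤ ·) (· ≤ ·)
      (fun x _ y _ => (i.le_iff_le (a := x) (b := y)).symm), List.map_map]
  refine List.map_congr_left fun x _ => ?_
  exact Finsupp.embDomain_apply_self _ _ _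

theorem expList_sum (d : ℕ →₀ ℕ) : (expList d).sum = d.degree := by
  unfold expList
  rw [Finsupp.degree_apply, ← Finset.sum_map_toList]
  exact ((Finset.sort_perm_toList d.support (· ≤ ·)).map d).sum_eq

theorem expList_pos (d : ℕ →₀ ℕ) : ∀ a ∈ expList d, 0 < a := by
  intro a ha
  obtain ⟨x, hx, rfl⟩ := List.mem_map.1 ha
  rw [Finset.mem_sort, Finsupp.mem_support_iff] at hx
  exact Nat.pos_of_ne_zero hx

/-- The power series `∑_{i_1 < ⋯ < i_m} x_{i_1}^{a_1} ⋯ x_{i_m}^{a_m}` attached to a list of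
positive integers `l = (a_1, …, a_m)`. -/
def monomialSeries (k : Type*) [Field k] (l : List ℕ) : MvPowerSeries ℕ k :=
  fun d => if expList d = l then 1 else 0

theorem coeff_monomialSeries (k : Type*) [Field k] (l : List ℕ) (d : ℕ →₀ ℕ) :
    MvPowerSeries.coeff d (monomialSeries k l) = if expList d = l then 1 else 0 := rfl

/-- The monomial quasi-symmetric function `M_(a_1, …, a_m)` of a list of positive integers. -/
def M (k : Type*) [Field k] (l : List ℕ) : QSym k :=
  ⟨monomialSeries k l, by
    refine ⟨fun m a i j => ?_, l.sum, fun d hd => ?_⟩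
    · simp only [coeff_monomialSeries, expList_embDomain]
    · rw [coeff_monomialSeries] at hd
      rw [← expList_sum]
      by_contra h
      have : expList d ≠ l := fun h' => h (h' ▸ le_rfl)
      simp [this] at hd⟩

theorem coeff_M (k : Type*) [Field k] (l : List ℕ) (d : ℕ →₀ ℕ) :
    MvPowerSeries.coeff d (M k l : MvPowerSeries ℕ k) = if expList d = l then 1 else 0 := rfl

/-- All compositions, of all non-negative integers, as lists of positive integers. -/
abbrev Comps : Type := {l : List ℕ // ∀ a ∈ l, 0 < a}

/-- The exponent vector of `x_0^{a_1} ⋯ x_{m-1}^{a_m}`. -/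
noncomputable def stdExp (l : List ℕ) : Fin l.length →₀ ℕ := Finsupp.equivFunOnFinite.symm l.get

theorem sort_univ_map_get (l : List ℕ) :
    ((Finset.univ : Finset (Fin l.length)).sort (· ≤ ·)).map l.get = l := by
  rw [Fin.sort_univ, List.map_get_finRange]

theorem expList_stdExp (l : Comps) (i : Fin l.1.length ↪o ℕ) :
    expList ((stdExp l.1).embDomain i.toEmbedding) = l.1 := by
  rw [expList_embDomain]
  have h : (stdExp l.1).support = Finset.univ := by
    ext x
    have := l.2 _ (List.get_mem l.1 x)
    simp only [Finsupp.mem_support_iff, Finset.mem_univ, iff_true]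
    exact this.ne'
  rw [h]
  exact sort_univ_map_get l.1

theorem exists_eq_embDomain (d : ℕ →₀ ℕ) :
    ∃ i : Fin (expList d).length ↪o ℕ, d = (stdExp (expList d)).embDomain i.toEmbedding := by
  have hl : (expList d).length = d.support.card := by simp [expList]
  refine ⟨d.support.orderEmbOfFin hl.symm, ?_⟩
  ext x
  by_cases hx : x ∈ d.support
  · have : x ∈ Set.range (d.support.orderEmbOfFin hl.symm) := by simpa using hx
    obtain ⟨y, rfl⟩ := this
    refine Eq.trans ?_ (Finsupp.embDomain_apply_self _ _ y).symm
    have hy : (y : ℕ) < (d.support.sort (· ≤ ·)).length := by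
      rw [Finset.length_sort, ← hl]
      exact y.2
    have h1 : (expList d).get y = d ((d.support.sort (· ≤ ·))[(y : ℕ)]'hy) :=
      List.getElem_map (⇑d)
    change _ = (expList d).get y
    rw [h1, Finset.orderEmbOfFin_apply]
    rfl
  · rw [Finsupp.embDomain_of_notMem_range]
    · simpa using hx
    · intro h
      apply hx
      have h2 : x ∈ Set.range (d.support.orderEmbOfFin hl.symm) := h
      simpa using h2

/-- The coefficient of `M_l` in `f`: the coefficient of `x_0^{a_1} ⋯ x_{m-1}^{a_m}` in `f`. -/
noncomputable def coeffM {k : Type*} [Field k] (l : List ℕ) (f : QSym k) : k :=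
  MvPowerSeries.coeff ((stdExp l).embDomain Fin.valEmbedding) (f : MvPowerSeries ℕ k)

theorem coeff_eq_coeffM {k : Type*} [Field k] (f : QSym k) (d : ℕ →₀ ℕ) :
    MvPowerSeries.coeff d (f : MvPowerSeries ℕ k) = coeffM (expList d) f := by
  obtain ⟨i, hi⟩ := exists_eq_embDomain d
  conv_lhs => rw [hi]
  exact f.2.1 _ _ i (Fin.valOrderEmb _)

theorem coeffM_M {k : Type*} [Field k] (l : Comps) (l' : List ℕ) :
    coeffM l.1 (M k l') = if l.1 = l' then 1 else 0 := by
  unfold coeffM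
  rw [coeff_M]
  have : expList ((stdExp l.1).embDomain Fin.valEmbedding) = l.1 :=
    expList_stdExp l (Fin.valOrderEmb _)
  rw [this]

theorem finite_comps_sum_le (N : ℕ) : {l : Comps | l.1.sum ≤ N}.Finite := by
  refine Set.Finite.subset (Set.finite_range
    fun p : Σ n : Fin (N + 1), Composition n => (⟨p.2.blocks, fun a ha => p.2.blocks_pos ha⟩ : Comps))
    ?_
  intro l hl
  exact ⟨⟨⟨l.1.sum, Nat.lt_succ_of_le hl⟩, ⟨l.1, fun {i} hi => l.2 i hi, rfl⟩⟩, rfl⟩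

/-- The basis of monomial quasi-symmetric functions. -/
noncomputable def basisM (k : Type*) [Field k] : Module.Basis Comps k (QSym k) :=
  Module.Basis.mk (v := fun l : Comps => M k l.1)
    (by
      rw [linearIndependent_iff']
      intro s g hg l hl
      have h := congrArg (fun f : QSym k => coeffM l.1 f) hg
      have hlin : ∀ f : QSym k, coeffM l.1 f = ((MvPowerSeries.coeff
          ((stdExp l.1).embDomain Fin.valEmbedding)).comp (QSym k).val.toLinearMap) f :=
        fun _ => rfl
      simp only [hlin, map_sum, map_smul, map_zero] at h
      simp only [← hlin, coeffM_M, smul_eq_mul, mul_ite, mul_one, mul_zero] at h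
      rw [Finset.sum_eq_single l] at h
      · simpa using h
      · intro b _ hb
        rw [if_neg fun h' => hb (Subtype.ext h'.symm)]
      · exact fun h' => absurd hl h')
    (by
      rintro f -
      obtain ⟨N, hN⟩ := f.2.2
      have hf : f = ∑ l ∈ (finite_comps_sum_le N).toFinset, coeffM l.1 f • M k l.1 := by
        apply Subtype.ext
        ext d
        have hlin : ∀ f : QSym k, MvPowerSeries.coeff d (f : MvPowerSeries ℕ k) =
            ((MvPowerSeries.coeff d).comp (QSym k).val.toLinearMap) f := fun _ => rfl
        rw [hlin, hlin]
        simp only [map_sum, map_smul]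
        simp only [← hlin, coeff_M, smul_eq_mul, mul_ite, mul_one, mul_zero]
        by_cases hd : d.degree ≤ N
        · rw [Finset.sum_eq_single (⟨expList d, expList_pos d⟩ : Comps)]
          · rw [if_pos rfl, coeff_eq_coeffM]
          · intro b _ hb
            rw [if_neg fun h' => hb (Subtype.ext h'.symm)]
          · intro h
            exact absurd (by simpa [expList_sum] using hd) h
        · rw [Finset.sum_eq_zero]
          · by_contra h
            exact hd (hN d h)
          · intro l hl
            rw [if_neg]
            intro h'
            apply hd
            rw [← expList_sum, h']
            simpa using hl
      rw [hf]
      exact Submodule.sum_mem _ fun l _ => Submodule.smul_mem _ _ (Submodule.subset_span ⟨l, rfl⟩))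

theorem basisM_apply (k : Type*) [Field k] (l : Comps) : basisM k l = M k l.1 := by
  unfold basisM
  rw [Module.Basis.mk_apply]

/-! ### The coalgebra structure -/

/-- The coproduct is determined by deconcatenation,
`Δ(M_(a_1, …, a_m)) = ∑_{i=0}^m M_(a_1, …, a_i) ⊗ M_(a_{i+1}, …, a_m)`,
and the counit is the constant coefficient. -/
noncomputable instance instCoalgebraStruct (k : Type*) [Field k] :
    CoalgebraStruct k (QSym k) where
  comul := (basisM k).constr k fun l : Comps =>
    ∑ i ∈ Finset.range (l.1.length + 1), M k (l.1.take i) ⊗ₜ[k] M k (l.1.drop i)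
  counit := (MvPowerSeries.coeff 0).comp (QSym k).val.toLinearMap

theorem comul_M (k : Type*) [Field k] (l : List ℕ) (hl : ∀ a ∈ l, 0 < a) :
    CoalgebraStruct.comul (R := k) (M k l) =
      ∑ i ∈ Finset.range (l.length + 1), M k (l.take i) ⊗ₜ[k] M k (l.drop i) := by
  have h := (basisM k).constr_basis k (fun l : Comps =>
    ∑ i ∈ Finset.range (l.1.length + 1), M k (l.1.take i) ⊗ₜ[k] M k (l.1.drop i)) ⟨l, hl⟩
  rw [basisM_apply] at h
  exact h

theorem expList_zero : expList 0 = [] := by simp [expList]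

theorem counit_M (k : Type*) [Field k] (l : List ℕ) :
    CoalgebraStruct.counit (R := k) (M k l) = if l = [] then 1 else 0 := by
  change MvPowerSeries.coeff 0 (M k l : MvPowerSeries ℕ k) = _
  rw [coeff_M, expList_zero]
  simp only [eq_comm]

theorem one_eq_M (k : Type*) [Field k] : (1 : QSym k) = M k [] := by
  classical
  apply Subtype.ext
  ext d
  rw [coeff_M]
  change MvPowerSeries.coeff d 1 = _
  rw [MvPowerSeries.coeff_one]
  have : expList d = [] ↔ d = 0 := by simp [expList, ← List.length_eq_zero_iff]
  simp only [this]

theorem pos_of_mem_take {l : List ℕ} (hl : ∀ a ∈ l, 0 < a) (i : ℕ) : ∀ a ∈ l.take i, 0 < a :=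
  fun a ha => hl a (List.mem_of_mem_take ha)

theorem pos_of_mem_drop {l : List ℕ} (hl : ∀ a ∈ l, 0 < a) (i : ℕ) : ∀ a ∈ l.drop i, 0 < a :=
  fun a ha => hl a (List.mem_of_mem_drop ha)

noncomputable instance instCoalgebra (k : Type*) [Field k] : Coalgebra k (QSym k) where
  coassoc := by
    refine (basisM k).ext fun l => ?_
    rw [basisM_apply]
    obtain ⟨l, hl⟩ := l
    simp only [LinearMap.comp_apply, LinearEquiv.coe_coe]
    rw [comul_M k l hl, map_sum, map_sum, map_sum]
    simp only [LinearMap.rTensor_tmul, LinearMap.lTensor_tmul]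
    simp only [comul_M k _ (pos_of_mem_take hl _), comul_M k _ (pos_of_mem_drop hl _),
      TensorProduct.sum_tmul, TensorProduct.tmul_sum, map_sum, TensorProduct.assoc_tmul]
    rw [Finset.sum_sigma', Finset.sum_sigma']
    refine Finset.sum_nbij' (fun p => ⟨p.2, p.1 - p.2⟩) (fun p => ⟨p.1 + p.2, p.1⟩) ?_ ?_ ?_ ?_ ?_
    · rintro ⟨i, j⟩ h
      simp only [Finset.mem_sigma, Finset.mem_range, List.length_take, List.length_drop] at h ⊢
      omega
    · rintro ⟨i, j⟩ h
      simp only [Finset.mem_sigma, Finset.mem_range, List.length_take, List.length_drop] at h ⊢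
      omega
    · rintro ⟨i, j⟩ h
      simp only [Finset.mem_sigma, Finset.mem_range, List.length_take] at h
      have : j + (i - j) = i := by omega
      simp [this]
    · rintro ⟨i, j⟩ h
      simp
    · rintro ⟨i, j⟩ h
      simp only [Finset.mem_sigma, Finset.mem_range, List.length_take] at h
      have h1 : j + (i - j) = i := by omega
      have h2 : min j i = j := by omega
      simp only [List.take_take, List.drop_drop, List.drop_take, h1, h2]
  rTensor_counit_comp_comul := by
    refine (basisM k).ext fun l => ?_
    rw [basisM_apply]
    obtain ⟨l, hl⟩ := l
    simp only [LinearMap.comp_apply]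
    rw [comul_M k l hl, map_sum]
    simp only [LinearMap.rTensor_tmul, counit_M]
    rw [Finset.sum_eq_single 0]
    · simp
    · intro i hi h0
      rw [Finset.mem_range] at hi
      rw [if_neg, TensorProduct.zero_tmul]
      intro h
      rw [List.take_eq_nil_iff] at h
      rcases h with h | h
      · exact h0 h
      · rw [h, List.length_nil] at hi
        omega
    · simp
  lTensor_counit_comp_comul := by
    refine (basisM k).ext fun l => ?_
    rw [basisM_apply]
    obtain ⟨l, hl⟩ := l
    simp only [LinearMap.comp_apply]
    rw [comul_M k l hl, map_sum]
    simp only [LinearMap.lTensor_tmul, counit_M]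
    rw [Finset.sum_eq_single l.length]
    · simp
    · intro i hi h0
      rw [Finset.mem_range] at hi
      rw [if_neg, TensorProduct.tmul_zero]
      intro h
      rw [List.drop_eq_nil_iff] at h
      omega
    · simp

/-! ### Linear functionals, convolution, even and odd parts -/

/-- The linear functionals on `QSym`; their multiplication `*` is the convolution product
`ρ ψ = m ∘ (ρ ⊗ ψ) ∘ Δ`, with unit the counit. -/
abbrev Functional (k : Type*) [Field k] : Type _ := WithConv (QSym k →ₗ[k] k)

/-- The power series `f(-x_0, -x_1, …)`. -/
noncomputable def negateVariables {k : Type*} [Field k] (f : MvPowerSeries ℕ k) :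
    MvPowerSeries ℕ k :=
  fun d => (-1) ^ d.degree * MvPowerSeries.coeff d f

theorem coeff_negateVariables {k : Type*} [Field k] (f : MvPowerSeries ℕ k) (d : ℕ →₀ ℕ) :
    MvPowerSeries.coeff d (negateVariables f) = (-1) ^ d.degree * MvPowerSeries.coeff d f := rfl

/-- The graded automorphism `h ↦ (-1)^n h` for `h` homogeneous of degree `n`. -/
noncomputable def degreeInvolution (k : Type*) [Field k] : QSym k →ₗ[k] QSym k where
  toFun f := ⟨negateVariables f, by
    have hdeg : ∀ (m : ℕ) (a : Fin m →₀ ℕ) (i : Fin m ↪o ℕ),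
        (a.embDomain i.toEmbedding).degree = a.degree := by
      intro m a i
      rw [Finsupp.embDomain_eq_mapDomain, Finsupp.degree_mapDomain]
    refine ⟨fun m a i j => ?_, ?_⟩
    · rw [coeff_negateVariables, coeff_negateVariables, hdeg, hdeg, f.2.1 m a i j]
    · obtain ⟨N, hN⟩ := f.2.2
      refine ⟨N, fun d hd => hN d ?_⟩
      rw [coeff_negateVariables] at hd
      exact right_ne_zero_of_mul hd⟩
  map_add' f g := by
    apply Subtype.ext
    funext d
    exact mul_add _ _ _
  map_smul' c f := by
    apply Subtype.ext
    funext d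
    exact mul_left_comm _ _ _

/-- The functional `h ↦ φ((-1)^n h)`, for `h` homogeneous of degree `n`. -/
noncomputable def bar {k : Type*} [Field k] (φ : Functional k) : Functional k :=
  WithConv.toConv (φ.ofConv ∘ₗ degreeInvolution k)

/-- A functional is even if it equals its bar. -/
def IsEvenFunctional {k : Type*} [Field k] (φ : Functional k) : Prop := bar φ = φ

/-- A functional is odd if it is invertible for convolution and its inverse is its bar. -/
def IsOddFunctional {k : Type*} [Field k] (φ : Functional k) : Prop :=
  φ * bar φ = 1 ∧ bar φ * φ = 1

/-- `ρ` is the even part `φ₊` and `ψ` is the odd part `φ₋` of the functional `φ`. -/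
structure IsEvenOddParts {k : Type*} [Field k] (φ ρ ψ : Functional k) : Prop where
  plus_one : ρ.ofConv 1 = 1
  minus_one : ψ.ofConv 1 = 1
  plus_even : IsEvenFunctional ρ
  minus_odd : IsOddFunctional ψ
  eq_mul : φ = ρ * ψ

theorem finite_support_coeff_single {k : Type*} [Field k] (f : QSym k) :
    (Function.support fun n : ℕ =>
      MvPowerSeries.coeff (Finsupp.single 0 n) (f : MvPowerSeries ℕ k)).Finite := by
  obtain ⟨N, hN⟩ := f.2.2
  refine (Set.finite_Iic N).subset fun n hn => ?_
  have := hN _ hn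
  rwa [Finsupp.degree_single] at this

/-- The universal character: it specializes `x_0` to `1` and all other variables to `0`. -/
noncomputable def zeta (k : Type*) [Field k] : Functional k := WithConv.toConv
  { toFun := fun f =>
      ∑ᶠ n : ℕ, MvPowerSeries.coeff (Finsupp.single 0 n) (f : MvPowerSeries ℕ k)
    map_add' := fun f g => by
      rw [← finsum_add_distrib (finite_support_coeff_single f) (finite_support_coeff_single g)]
      rfl
    map_smul' := fun c f => by
      exact (smul_finsum' c (finite_support_coeff_single f)).symm }

/-! ### The fundamental basis -/

/-- The fundamental quasi-symmetric function `F_α`, the sum of the `M_β` over all refinements `β`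
of the composition `α` of `n`. -/
noncomputable def F (k : Type*) [Field k] {n : ℕ} (α : Composition n) : QSym k :=
  ∑ β : Composition n with α.boundaries ⊆ β.boundaries, M k β.blocks

/-! ### Statistics on compositions and bivariate Catalan numbers -/

/-- The number of parts greater than `1` other than the last part. -/
def peakMinus {n : ℕ} (α : Composition n) : ℕ :=
  Finset.card {i : Fin α.length | (i : ℕ) + 1 ≠ α.length ∧ 1 < α.blocksFun i}

/-- One plus the number of parts greater than `1` other than the first and the last part, for
compositions with at least two parts; otherwise `0`. -/
def peakPlus {n : ℕ} (α : Composition n) : ℕ :=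
  if 1 < α.length then
    1 + Finset.card
      {i : Fin α.length | (i : ℕ) ≠ 0 ∧ (i : ℕ) + 1 ≠ α.length ∧ 1 < α.blocksFun i}
  else 0

/-- The conjugate composition: its ribbon diagram is the reflection of the one of `α` across
`y = x`. The reflection exchanges horizontal and vertical adjacency of consecutive squares and
reverses their order, so the partial sums strictly between `0` and `n` of the conjugate are the
numbers `n - i`, for those `0 < i < n` that are not partial sums of `α`. -/
def conjugate {n : ℕ} (α : Composition n) : Composition n :=
  CompositionAsSet.toComposition
    { boundaries := {i | i = 0 ∨ i = Fin.last n ∨ Fin.rev i ∉ α.boundaries}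
      zero_mem := by simp
      getLast_mem := by simp }

/-- The bivariate Catalan number `C(m, n) = (2m)! (2n)! / (m! (m+n)! n!)`. -/
def bivariateCatalan (m n : ℕ) : ℕ :=
  ((2 * m).factorial * (2 * n).factorial) / (m.factorial * (m + n).factorial * n.factorial)

/-- The division in the definition of the bivariate Catalan numbers is exact. -/
theorem bivariateCatalan_mul (m n : ℕ) :
    bivariateCatalan m n * (m.factorial * (m + n).factorial * n.factorial) =
      (2 * m).factorial * (2 * n).factorial := by
  have key : ∀ n m : ℕ, ∃ c : ℤ, ((2 * m).factorial * (2 * n).factorial : ℤ) =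
      (m.factorial * (m + n).factorial * n.factorial) * c := by
    intro n
    induction n with
    | zero =>
      intro m
      refine ⟨m.centralBinom, ?_⟩
      have h := Nat.choose_mul_factorial_mul_factorial (n := 2 * m) (k := m) (by omega)
      have h2 : 2 * m - m = m := by omega
      rw [h2] at h
      rw [Nat.centralBinom]
      simp only [mul_zero, Nat.factorial_zero, Nat.cast_one, mul_one, add_zero]
      exact_mod_cast (by rw [← h]; ring)
    | succ n ih =>
      intro m
      obtain ⟨c, hc⟩ := ih m
      obtain ⟨c', hc'⟩ := ih (m + 1)
      refine ⟨4 * c - c', ?_⟩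
      have e1 : m + 1 + n = (m + n) + 1 := by omega
      have e2 : m + (n + 1) = (m + n) + 1 := by omega
      have e3 : 2 * (m + 1) = (2 * m + 1) + 1 := by omega
      have e4 : 2 * (n + 1) = (2 * n + 1) + 1 := by omega
      rw [e1, e3] at hc'
      rw [e2, e4]
      simp only [Nat.factorial_succ] at hc' ⊢
      push_cast at hc' ⊢
      have hm : ((m : ℤ) + 1) ≠ 0 := by positivity
      apply mul_left_cancel₀ hm
      linear_combination (4 * (m + 1) * (m + n + 1) * (n + 1)) * hc - (n + 1) * hc'
  obtain ⟨c, hc⟩ := key n m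
  refine Nat.div_mul_cancel ?_
  zify
  exact ⟨c, hc⟩

end QuasiSym

/-! A functional is determined by its values on the monomial basis, where convolution becomes a sum
over the cuts of a list. To a sequence `c`, read as a power series, two functionals are attached:
`parityWeight c`, which sends a list with `e` even and `o` odd entries to `(-1)^e * c o`, and
`oddWeight c`, which agrees with it except that it kills lists with an even head. Multiplying either
kind on the right by an `oddWeight` multiplies the power series, and `bar` acts as `X ↦ -X`, because
the sum of a list has the parity of `o`.

The inverse of `ζ` takes the value `(-1)^(e+o)`, so it is `parityWeight` of the series `1 / (1 +
X)`. The factorization of this series as `(1 - X²)^(-1/2)` times `((1 - X) / (1 + X))^(1/2)`, an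
even series times a series `O` with `O(X) O(-X) = 1`, gives the even and odd parts
(`isEvenOddParts_inverse_zeta`). They are unique because the square of the odd part is determined
and convolution square roots with value `1` at `1` are unique when `2 ≠ 0`.

The value at `F_α` is a sum over refinements, which is carried out one part at a time. A part `1`
shifts the sequence by one. A part `a > 1` replaces `c i` by `c (i + a) - c (i + a - 2)`, since
refinements with odd and even heads contribute with opposite signs. For `oddWeight` the first part
of `α` only shifts. Thus the sum is the `p`-th iterate of `c (i + 2) - c i` at `n - 2p`, where `p`
counts the parts greater than `1`, without the first part in the odd case. For the coefficients at
hand, central binomials over powers of `4`, the iterates are bivariate Catalan numbers by `C(m+1, n)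
+ C(m, n+1) = 4 C(m, n)`. Finally `p` is identified with `p₋` of the reversal and `p₊` of the
conjugate. -/

namespace QuasiSym

/-! ### Convolution on the monomial basis and uniqueness of even and odd parts. -/

section Functionals

variable {k : Type*} [Field k]

/-- The value of a functional on a monomial quasi-symmetric function. -/
noncomputable def valM (φ : Functional k) (l : List ℕ) : k := φ.ofConv (M k l)

theorem functional_ext {φ ψ : Functional k}
    (h : ∀ l : List ℕ, (∀ a ∈ l, 0 < a) → valM φ l = valM ψ l) : φ = ψ := by
  apply WithConv.ofConv_injective
  refine (basisM k).ext fun l => ?_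
  rw [basisM_apply]
  exact h l.1 l.2

theorem valM_mul (φ ψ : Functional k) {l : List ℕ} (hl : ∀ a ∈ l, 0 < a) :
    valM (φ * ψ) l =
      ∑ i ∈ Finset.range (l.length + 1), valM φ (l.take i) * valM ψ (l.drop i) := by
  unfold valM
  rw [LinearMap.convMul_def]
  change LinearMap.mul' k k (TensorProduct.map φ.ofConv ψ.ofConv
    (CoalgebraStruct.comul (R := k) (M k l))) = _
  rw [comul_M k l hl, map_sum, map_sum]
  rfl

theorem valM_one (l : List ℕ) : valM (1 : Functional k) l = if l = [] then 1 else 0 := by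
  unfold valM
  rw [← counit_M k l]
  rfl

theorem valM_nil (φ : Functional k) : valM φ [] = φ.ofConv 1 := by
  rw [valM, one_eq_M]

theorem degreeInvolution_M (l : List ℕ) :
    degreeInvolution k (M k l) = (-1 : k) ^ l.sum • M k l := by
  apply Subtype.ext
  ext d
  change (-1) ^ d.degree * MvPowerSeries.coeff d (M k l : MvPowerSeries ℕ k) =
    (-1) ^ l.sum * MvPowerSeries.coeff d (M k l : MvPowerSeries ℕ k)
  rw [coeff_M]
  split_ifs with h
  · rw [← expList_sum, h]
  · simp

theorem valM_bar (φ : Functional k) (l : List ℕ) :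
    valM (bar φ) l = (-1) ^ l.sum * valM φ l := by
  change φ.ofConv (degreeInvolution k (M k l)) = _
  rw [degreeInvolution_M, map_smul]
  rfl

theorem expList_single (n : ℕ) (hn : n ≠ 0) : expList (Finsupp.single 0 n) = [n] := by
  simp [expList, Finsupp.support_single, hn]

theorem valM_zeta {l : List ℕ} (hl : ∀ a ∈ l, 0 < a) :
    valM (zeta k) l = if l.length ≤ 1 then 1 else 0 := by
  have h0 : valM (zeta k) l =
      ∑ᶠ n : ℕ, if expList (Finsupp.single 0 n) = l then (1 : k) else 0 := rfl
  have hexp : ∀ n, expList (Finsupp.single 0 n) = if n = 0 then [] else [n] := by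
    intro n
    split_ifs with h
    · rw [h, Finsupp.single_zero, expList_zero]
    · exact expList_single n h
  rw [h0]
  simp only [hexp]
  match l, hl with
  | [], _ =>
    rw [finsum_eq_single _ 0 (by intro n hn; simp [hn])]
    simp
  | [a], hl =>
    have ha : a ≠ 0 := (hl a (by simp)).ne'
    rw [finsum_eq_single _ a (by intro n hn; by_cases h : n = 0 <;> simp [h, hn])]
    simp [ha]
  | a :: b :: l, _ =>
    rw [finsum_eq_zero_of_forall_eq_zero]
    · simp
    · intro n
      by_cases h : n = 0 <;> simp [h]

theorem bar_mul (φ ψ : Functional k) : bar (φ * ψ) = bar φ * bar ψ := by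
  refine functional_ext fun l hl => ?_
  rw [valM_bar, valM_mul φ ψ hl, valM_mul _ _ hl, Finset.mul_sum]
  refine Finset.sum_congr rfl fun i _ => ?_
  rw [valM_bar, valM_bar, ← List.sum_take_add_sum_drop l i, pow_add]
  ring

theorem bar_one : bar (1 : Functional k) = 1 := by
  refine functional_ext fun l _ => ?_
  rw [valM_bar, valM_one]
  split_ifs with h
  · simp [h]
  · simp

/-- The functional with prescribed values on the monomial basis. -/
noncomputable def ofValues (w : List ℕ → k) : Functional k :=
  WithConv.toConv ((basisM k).constr k fun l : Comps => w l.1)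

theorem valM_ofValues (w : List ℕ → k) {l : List ℕ} (hl : ∀ a ∈ l, 0 < a) :
    valM (ofValues w) l = w l := by
  have h := (basisM k).constr_basis k (fun l : Comps => w l.1) ⟨l, hl⟩
  rw [basisM_apply] at h
  exact h

/-- Square roots of functionals taking the value `1` at `1` are unique. -/
theorem eq_of_mul_self_eq (h2 : (2 : k) ≠ 0) {φ ψ : Functional k} (hφ : φ.ofConv 1 = 1)
    (hψ : ψ.ofConv 1 = 1) (h : φ * φ = ψ * ψ) : φ = ψ := by
  have key : ∀ (n : ℕ) (l : List ℕ), l.length = n → (∀ a ∈ l, 0 < a) →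
      valM φ l = valM ψ l := by
    intro n
    induction n using Nat.strong_induction_on with
    | _ n ih =>
    intro l hn hl
    rcases n with _ | n
    · rw [List.length_eq_zero_iff] at hn
      rw [hn, valM_nil, valM_nil, hφ, hψ]
    · have e := congrArg (fun χ => valM χ l) h
      simp only [valM_mul _ _ hl, hn] at e
      rw [Finset.sum_range_succ _ (n + 1), Finset.sum_range_succ _ (n + 1),
        Finset.sum_range_succ' _ n, Finset.sum_range_succ' _ n] at e
      -- Interior cuts only involve shorter lists and agree by induction. Each of the two extreme
      -- cuts contributes the value at `l`, so twice that value is determined.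
      have hmid : ∑ i ∈ Finset.range n, valM φ (l.take (i + 1)) * valM φ (l.drop (i + 1)) =
          ∑ i ∈ Finset.range n, valM ψ (l.take (i + 1)) * valM ψ (l.drop (i + 1)) := by
        refine Finset.sum_congr rfl fun i hi => ?_
        rw [Finset.mem_range] at hi
        rw [ih (i + 1) (by omega) _ (by rw [List.length_take]; omega) (pos_of_mem_take hl _),
          ih (n - i) (by omega) _ (by rw [List.length_drop]; omega) (pos_of_mem_drop hl _)]
      have ht : l.take (n + 1) = l := List.take_of_length_le hn.le
      have hd : l.drop (n + 1) = [] := List.drop_of_length_le hn.le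
      rw [hmid, ht, hd, List.take_zero, List.drop_zero] at e
      simp only [valM_nil, hφ, hψ, one_mul, mul_one] at e
      apply mul_left_cancel₀ h2
      linear_combination e
  exact functional_ext fun l hl => key _ l rfl hl

/-- From `φ = ρ ψ` one gets `bar φ = ρ ψ⁻¹`, hence `bar φ * ψ² = φ`. As `bar φ` is invertible, `ψ²`
is determined, then `ψ`, then `ρ = φ ψ⁻¹`. -/
theorem IsEvenOddParts.unique (h2 : (2 : k) ≠ 0) {φ ρ ψ ρ' ψ' : Functional k} (hφ : IsUnit φ)
    (h : IsEvenOddParts φ ρ ψ) (h' : IsEvenOddParts φ ρ' ψ') : ρ = ρ' ∧ ψ = ψ' := by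
  have hbar : IsUnit (bar φ) := by
    obtain ⟨u, rfl⟩ := hφ
    exact ⟨⟨bar u, bar (u⁻¹ : (Functional k)ˣ), by rw [← bar_mul, u.mul_inv, bar_one],
      by rw [← bar_mul, u.inv_mul, bar_one]⟩, rfl⟩
  have key : ∀ {ρ ψ : Functional k}, IsEvenOddParts φ ρ ψ →
      bar φ * (ψ * ψ) = φ ∧ ρ = φ * bar ψ := by
    intro ρ ψ h
    have hρ : bar ρ = ρ := h.plus_even
    constructor
    · rw [h.eq_mul, bar_mul, hρ, mul_assoc, ← mul_assoc (bar ψ), h.minus_odd.2, one_mul]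
    · rw [h.eq_mul, mul_assoc, h.minus_odd.1, mul_one]
  have hψ : ψ = ψ' := by
    refine eq_of_mul_self_eq h2 h.minus_one h'.minus_one ?_
    exact hbar.mul_left_cancel ((key h).1.trans (key h').1.symm)
  exact ⟨by rw [(key h).2, (key h').2, hψ], hψ⟩

end Functionals

/-! ### Functionals depending on parities of entries, multiplied like power series. -/

section Parity

variable {k : Type*} [Field k]

/-- `(-1)^e c_o`, where the list has `e` even and `o` odd entries. -/
def parityWeight : (ℕ → k) → List ℕ → k
  | c, [] => c 0
  | c, a :: l => if Even a then -parityWeight c l else parityWeight (fun i => c (i + 1)) l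

/-- The weight `parityWeight`, restricted to the lists that do not start with an even entry. -/
def oddWeight (c : ℕ → k) : List ℕ → k
  | [] => c 0
  | a :: l => if Even a then 0 else parityWeight (fun i => c (i + 1)) l

theorem parityWeight_cons (c : ℕ → k) (a : ℕ) (l : List ℕ) : parityWeight c (a :: l) =
    if Even a then -parityWeight c l else parityWeight (fun i => c (i + 1)) l := rfl

theorem oddWeight_cons (c : ℕ → k) (a : ℕ) (l : List ℕ) : oddWeight c (a :: l) =
    if Even a then 0 else parityWeight (fun i => c (i + 1)) l := rfl

theorem oddWeight_nil (c : ℕ → k) : oddWeight c [] = c 0 := rfl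

/-- The coefficients of the product of two power series. -/
def cauchyProduct (c d : ℕ → k) (n : ℕ) : k :=
  ∑ p ∈ Finset.HasAntidiagonal.antidiagonal n, c p.1 * d p.2

theorem cauchyProduct_zero (c d : ℕ → k) : cauchyProduct c d 0 = c 0 * d 0 := by
  simp [cauchyProduct]

theorem parityWeight_linear (x : k) (c d : ℕ → k) (l : List ℕ) :
    parityWeight (fun i => x * c i + d i) l = x * parityWeight c l + parityWeight d l := by
  induction l generalizing c d with
  | nil => rfl
  | cons a l ih =>
    simp only [parityWeight]
    split_ifs
    · rw [ih c d]; ring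
    · exact ih _ _

theorem cauchyProduct_succ (c d : ℕ → k) (n : ℕ) :
    cauchyProduct c d (n + 1) = c 0 * d (n + 1) + cauchyProduct (fun i => c (i + 1)) d n := by
  rw [cauchyProduct, Finset.Nat.sum_antidiagonal_succ]
  rfl

theorem sum_take_drop_cons (f g : List ℕ → k) (a : ℕ) (l : List ℕ) :
    ∑ i ∈ Finset.range ((a :: l).length + 1), f ((a :: l).take i) * g ((a :: l).drop i) =
      (∑ i ∈ Finset.range (l.length + 1), f (a :: l.take i) * g (l.drop i)) +
        f [] * g (a :: l) := by
  rw [List.length_cons, Finset.sum_range_succ']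
  rfl

/-- A cut contributes only at the end of `l` or just before an odd entry. Such cuts are indexed by
the number `i` of odd entries to their left, which takes every value from `0` to the total `o`, and
the signs always multiply to `(-1)^e`. What remains is the sum of `c i * d (o - i)`. -/
theorem sum_parityWeight_mul_oddWeight (c d : ℕ → k) (l : List ℕ) :
    ∑ i ∈ Finset.range (l.length + 1), parityWeight c (l.take i) * oddWeight d (l.drop i) =
      parityWeight (cauchyProduct c d) l := by
  induction l generalizing c with
  | nil => simp [parityWeight, oddWeight, cauchyProduct_zero]
  | cons a l ih =>
    rw [sum_take_drop_cons]
    simp only [parityWeight_cons, oddWeight_cons]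
    split_ifs
    · rw [mul_zero, add_zero, ← ih c, ← Finset.sum_neg_distrib]
      exact Finset.sum_congr rfl fun i _ => by ring
    · rw [ih, add_comm, parityWeight, ← parityWeight_linear]
      simp only [cauchyProduct_succ]

theorem sum_oddWeight_mul_oddWeight (c d : ℕ → k) (l : List ℕ) :
    ∑ i ∈ Finset.range (l.length + 1), oddWeight c (l.take i) * oddWeight d (l.drop i) =
      oddWeight (cauchyProduct c d) l := by
  cases l with
  | nil => simp [oddWeight, cauchyProduct_zero]
  | cons a l =>
    rw [sum_take_drop_cons]
    simp only [oddWeight_cons, oddWeight_nil]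
    split_ifs
    · simp
    · rw [sum_parityWeight_mul_oddWeight, add_comm, ← parityWeight_linear]
      simp only [cauchyProduct_succ]

theorem ofValues_parityWeight_mul (c d : ℕ → k) :
    ofValues (parityWeight c) * ofValues (oddWeight d) =
      ofValues (parityWeight (cauchyProduct c d)) := by
  refine functional_ext fun l hl => ?_
  rw [valM_mul _ _ hl, valM_ofValues _ hl, ← sum_parityWeight_mul_oddWeight]
  exact Finset.sum_congr rfl fun i _ => by
    rw [valM_ofValues _ (pos_of_mem_take hl i), valM_ofValues _ (pos_of_mem_drop hl i)]

theorem ofValues_oddWeight_mul (c d : ℕ → k) :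
    ofValues (oddWeight c) * ofValues (oddWeight d) =
      ofValues (oddWeight (cauchyProduct c d)) := by
  refine functional_ext fun l hl => ?_
  rw [valM_mul _ _ hl, valM_ofValues _ hl, ← sum_oddWeight_mul_oddWeight]
  exact Finset.sum_congr rfl fun i _ => by
    rw [valM_ofValues _ (pos_of_mem_take hl i), valM_ofValues _ (pos_of_mem_drop hl i)]

/-- The number of odd entries is congruent to the sum modulo `2`. The factor `x` absorbs the sign
produced by shifting the sequence in the induction. -/
theorem parityWeight_alternating (x : k) (c : ℕ → k) (l : List ℕ) :
    parityWeight (fun i => x * (-1) ^ i * c i) l = x * (-1) ^ l.sum * parityWeight c l := by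
  induction l generalizing x c with
  | nil => simp [parityWeight]
  | cons a l ih =>
    simp only [parityWeight, List.sum_cons, pow_add]
    split_ifs with h
    · rw [ih, h.neg_one_pow]; ring
    · rw [(Nat.not_even_iff_odd.1 h).neg_one_pow, mul_comm (-1) ((-1) ^ l.sum), ← mul_assoc,
        mul_right_comm, mul_neg_one, ← neg_mul, ← mul_neg, mul_neg, ← neg_mul, ← ih]
      congr 1
      funext i
      ring

theorem oddWeight_alternating (c : ℕ → k) (l : List ℕ) :
    oddWeight (fun i => (-1) ^ i * c i) l = (-1) ^ l.sum * oddWeight c l := by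
  cases l with
  | nil => simp [oddWeight]
  | cons a l =>
    simp only [oddWeight, List.sum_cons, pow_add]
    split_ifs with h
    · simp
    · have := parityWeight_alternating (-1 : k) (fun i => c (i + 1)) l
      rw [(Nat.not_even_iff_odd.1 h).neg_one_pow, ← this]
      congr 1
      funext i
      ring

theorem bar_ofValues_parityWeight (c : ℕ → k) :
    bar (ofValues (parityWeight c)) = ofValues (parityWeight fun i => (-1) ^ i * c i) := by
  refine functional_ext fun l hl => ?_
  have := parityWeight_alternating (1 : k) c l
  simp only [one_mul] at this
  rw [valM_bar, valM_ofValues _ hl, valM_ofValues _ hl, this]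

theorem bar_ofValues_oddWeight (c : ℕ → k) :
    bar (ofValues (oddWeight c)) = ofValues (oddWeight fun i => (-1) ^ i * c i) := by
  refine functional_ext fun l hl => ?_
  rw [valM_bar, valM_ofValues _ hl, valM_ofValues _ hl, oddWeight_alternating]

theorem parityWeight_neg_one_pow (x : k) (l : List ℕ) :
    parityWeight (fun i => x * (-1) ^ i) l = x * (-1) ^ l.length := by
  induction l generalizing x with
  | nil => simp [parityWeight]
  | cons a l ih =>
    simp only [parityWeight, List.length_cons, pow_succ]
    split_ifs
    · rw [ih]; ring
    · have e : ∀ i, x * ((-1) ^ i * -1) = -x * (-1) ^ i := fun i => by ring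
      simp only [e]
      exact ih (-x)

theorem oddWeight_single (l : List ℕ) :
    oddWeight (fun i => if i = 0 then (1 : k) else 0) l = if l = [] then 1 else 0 := by
  have h0 : ∀ l, parityWeight (fun _ => (0 : k)) l = 0 := fun l => by
    simpa using parityWeight_neg_one_pow (0 : k) l
  cases l with
  | nil => simp [oddWeight]
  | cons a l => simp [oddWeight, h0]

theorem ofValues_oddWeight_single :
    ofValues (oddWeight fun i => if i = 0 then (1 : k) else 0) = 1 := by
  refine functional_ext fun l hl => ?_
  rw [valM_ofValues _ hl, oddWeight_single, valM_one]

/-- The functional `M_(a_1, …, a_m) ↦ (-1)^m` is the convolution inverse of `ζ`. -/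
theorem zeta_mul_alternating :
    zeta k * ofValues (fun l => (-1) ^ l.length) = 1 := by
  refine functional_ext fun l hl => ?_
  have hz : ∀ i, valM (zeta k) (l.take i) = if (l.take i).length ≤ 1 then 1 else 0 :=
    fun i => valM_zeta (pos_of_mem_take hl i)
  rw [valM_mul _ _ hl, valM_one]
  cases l with
  | nil => simp [valM_zeta, valM_ofValues]
  | cons a l =>
    rw [List.length_cons, Finset.sum_range_succ', Finset.sum_range_succ',
      Finset.sum_eq_zero, if_neg (by simp)]
    · rw [hz, hz, valM_ofValues _ (pos_of_mem_drop hl _), valM_ofValues _ (pos_of_mem_drop hl _)]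
      simp [pow_succ]
    · intro i hi
      rw [Finset.mem_range] at hi
      rw [hz, if_neg, zero_mul]
      simp only [List.length_take, List.length_cons]
      omega

/-- Convolution is not commutative, so invertibility needs the other side as well. Here only the
last two cuts survive, and they cancel. -/
theorem alternating_mul_zeta :
    ofValues (fun l => (-1) ^ l.length) * zeta k = 1 := by
  refine functional_ext fun l hl => ?_
  have hz : ∀ i, valM (zeta k) (l.drop i) = if (l.drop i).length ≤ 1 then 1 else 0 :=
    fun i => valM_zeta (pos_of_mem_drop hl i)
  rw [valM_mul _ _ hl, valM_one]
  rcases hn : l.length with _ | n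
  · rw [List.length_eq_zero_iff] at hn
    subst hn
    simp [valM_zeta, valM_ofValues]
  · rw [Finset.sum_range_succ, Finset.sum_range_succ, Finset.sum_eq_zero, if_neg]
    · rw [hz, hz, valM_ofValues _ (pos_of_mem_take hl _), valM_ofValues _ (pos_of_mem_take hl _)]
      simp [pow_succ, hn]
    · rintro rfl
      simp at hn
    · intro i hi
      rw [Finset.mem_range] at hi
      rw [hz, if_neg, mul_zero]
      simp only [List.length_drop]
      omega

theorem isUnit_zeta : IsUnit (zeta k) :=
  ⟨⟨_, _, zeta_mul_alternating, alternating_mul_zeta⟩, rfl⟩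

theorem inverse_zeta : Ring.inverse (zeta k) = ofValues (parityWeight fun i => (-1) ^ i) := by
  have h : Ring.inverse (zeta k) = ofValues (fun l => (-1) ^ l.length) :=
    Ring.inverse_unit (⟨_, _, zeta_mul_alternating, alternating_mul_zeta⟩ : (Functional k)ˣ)
  rw [h]
  congr 1
  funext l
  simpa using (parityWeight_neg_one_pow (1 : k) l).symm

end Parity

/-! ### The series `(1 - X²)^(-1/2)` and `((1 - X) / (1 + X))^(1/2)`. -/

section Parts

open PowerSeries

/-- The power series `∑ (2j choose j) X^(2j)`, which is `(1 - 4 X²)^(-1/2)`. -/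
def centralBinomSeries : PowerSeries ℤ :=
  PowerSeries.mk fun n => if Even n then ((n / 2).centralBinom : ℤ) else 0

/-- The differential equation of `(1 - 4X²)^(-1/2)`; on coefficients it is the recurrence
`Nat.succ_mul_centralBinom_succ`. -/
theorem centralBinomSeries_derivative :
    (1 - 4 * X ^ 2) * d⁄dX ℤ centralBinomSeries = 4 * X * centralBinomSeries := by
  have hc : ∀ (f : PowerSeries ℤ) (n : ℕ), coeff n (4 * f) = 4 * coeff n f := by
    intro f n
    rw [← map_ofNat (C (R := ℤ)) 4, coeff_C_mul]
  ext n
  rw [sub_mul, one_mul, map_sub, mul_assoc, mul_assoc, hc, hc]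
  match n with
  | 0 => simp [coeff_derivative, centralBinomSeries, coeff_X_pow_mul']
  | 1 =>
    rw [coeff_succ_X_mul]
    simp [coeff_derivative, centralBinomSeries, coeff_X_pow_mul', Nat.centralBinom]
  | n + 2 =>
    rw [coeff_X_pow_mul, coeff_succ_X_mul]
    simp only [coeff_derivative, centralBinomSeries, coeff_mk]
    rcases Nat.even_or_odd' n with ⟨j, rfl | rfl⟩
    · simp [Nat.even_add_one]
    · have e1 : (2 * j + 1 + 2 + 1) / 2 = j + 2 := by omega
      have e2 : (2 * j + 1 + 1) / 2 = j + 1 := by omega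
      rw [e1, e2, if_pos ⟨j + 2, by ring⟩, if_pos ⟨j + 1, by ring⟩]
      have := congrArg (Nat.cast : ℕ → ℤ) (Nat.succ_mul_centralBinom_succ (j + 1))
      push_cast at this ⊢
      linear_combination 2 * this

/-- The left side has derivative zero and constant term `1`. The argument takes place over `ℤ`
because in positive characteristic the derivative does not determine a series up to a constant. -/
theorem centralBinomSeries_sq : centralBinomSeries ^ 2 * (1 - 4 * X ^ 2) = 1 := by
  apply derivative.ext
  · have h := centralBinomSeries_derivative
    have h4 : d⁄dX ℤ (4 : PowerSeries ℤ) = 0 := by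
      rw [← map_ofNat (C (R := ℤ)) 4, derivative_C]
    simp only [Derivation.leibniz, Derivation.leibniz_pow, map_sub, Derivation.map_one_eq_zero,
      smul_eq_mul, derivative_X, h4]
    simp only [nsmul_eq_mul]
    push_cast
    linear_combination (2 * centralBinomSeries) * h
  · simp [centralBinomSeries]

variable {k : Type*} [Field k]

/-- The numbers `(2j choose j) / 4^j`, each occurring twice. -/
def halfBinom (k : Type*) [Field k] (n : ℕ) : k := ((n / 2).centralBinom : k) / 4 ^ (n / 2)

/-- The coefficients of `(1 - X²)^(-1/2)`. -/
def evenCoeff (k : Type*) [Field k] (n : ℕ) : k := if Even n then halfBinom k n else 0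

/-- The coefficients of `((1 - X) / (1 + X))^(1/2)`. -/
def oddCoeff (k : Type*) [Field k] (n : ℕ) : k := (-1) ^ n * halfBinom k n

/-- The integral identity is mapped to `k` and rescaled by `X ↦ X / 2`, which turns `4X²` into `X²`.
-/
theorem mk_evenCoeff_sq (h2 : (2 : k) ≠ 0) :
    (mk (evenCoeff k)) ^ 2 * (1 - X ^ 2) = 1 := by
  have h := congrArg (fun f => rescale (2⁻¹ : k) (PowerSeries.map (Int.castRingHom k) f))
    centralBinomSeries_sq
  simp only [map_mul, map_pow, map_sub, map_one, map_X, rescale_X] at h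
  have h4 : rescale (2⁻¹ : k) (PowerSeries.map (Int.castRingHom k) 4) * (C (2⁻¹ : k) * X) ^ 2 =
      X ^ 2 := by
    rw [map_ofNat, map_ofNat, mul_pow, ← mul_assoc, ← map_ofNat (C (R := k)) 4,
      ← map_pow, ← map_mul]
    have : (4 : k) * 2⁻¹ ^ 2 = 1 := by field_simp; norm_num
    rw [this, map_one, one_mul]
  have hS : rescale (2⁻¹ : k) (PowerSeries.map (Int.castRingHom k) centralBinomSeries) =
      mk (evenCoeff k) := by
    ext n
    rw [coeff_rescale, coeff_map, centralBinomSeries, coeff_mk, coeff_mk, evenCoeff]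
    split_ifs with hn
    · obtain ⟨j, rfl⟩ := hn
      have e : (j + j) / 2 = j := by omega
      rw [halfBinom, e, ← two_mul, pow_mul, inv_pow, inv_pow, show (2 : k) ^ 2 = 4 by norm_num,
        div_eq_inv_mul]
      simp
    · simp
  rw [h4, hS] at h
  exact h

/-- Since `((1 - X) / (1 + X))^(1/2) = (1 - X)(1 - X²)^(-1/2)`, each coefficient of the even series
occurs twice, the second time negated. -/
theorem mk_oddCoeff : mk (oddCoeff k) = (1 - X) * mk (evenCoeff k) := by
  ext n
  rw [sub_mul, one_mul, map_sub]
  cases n with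
  | zero => simp [oddCoeff, evenCoeff]
  | succ n =>
    rw [coeff_succ_X_mul, coeff_mk, coeff_mk, coeff_mk, oddCoeff, evenCoeff, evenCoeff]
    rcases Nat.even_or_odd' n with ⟨j, rfl | rfl⟩
    · have e : (2 * j + 1) / 2 = 2 * j / 2 := by omega
      simp [pow_succ, halfBinom, e]
    · simp [Nat.even_add_one, pow_succ]

theorem mk_oddCoeff_alternating :
    mk (fun n => (-1) ^ n * oddCoeff k n) = (1 + X) * mk (evenCoeff k) := by
  have h := congrArg (rescale (-1 : k)) (mk_oddCoeff (k := k))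
  rw [rescale_mk, map_mul, map_sub, map_one, rescale_neg_one_X, rescale_mk, sub_neg_eq_add] at h
  rw [h]
  congr 2
  funext n
  rw [evenCoeff]
  split_ifs with hn
  · simp [hn.neg_one_pow]
  · simp

theorem cauchyProduct_eq_coeff (c d : ℕ → k) (n : ℕ) :
    cauchyProduct c d n = coeff n (mk c * mk d) := by
  rw [coeff_mul]
  simp [cauchyProduct]

theorem cauchyProduct_evenCoeff_oddCoeff (h2 : (2 : k) ≠ 0) :
    cauchyProduct (evenCoeff k) (oddCoeff k) = fun n => (-1) ^ n := by
  have h : mk (evenCoeff k) * mk (oddCoeff k) = mk fun n => (-1) ^ n := by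
    have h1 : (1 + X) * (mk (evenCoeff k) * mk (oddCoeff k)) = 1 := by
      rw [mk_oddCoeff]
      linear_combination mk_evenCoeff_sq h2
    have h3 : (mk fun n => (-1 : k) ^ n) * (1 + X) = 1 := by
      ext n
      rw [mul_add, mul_one, map_add]
      cases n with
      | zero => simp
      | succ n => rw [coeff_succ_mul_X]; simp [coeff_one, pow_succ]
    calc _ = ((mk fun n => (-1 : k) ^ n) * (1 + X)) * (mk (evenCoeff k) * mk (oddCoeff k)) := by
          rw [h3, one_mul]
      _ = _ := by rw [mul_assoc, h1, mul_one]
  funext n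
  rw [cauchyProduct_eq_coeff, h, coeff_mk]

theorem cauchyProduct_comm (c d : ℕ → k) : cauchyProduct c d = cauchyProduct d c := by
  funext n
  rw [cauchyProduct_eq_coeff, cauchyProduct_eq_coeff, mul_comm]

theorem cauchyProduct_oddCoeff_alternating (h2 : (2 : k) ≠ 0) :
    cauchyProduct (oddCoeff k) (fun n => (-1) ^ n * oddCoeff k n) =
      fun n => if n = 0 then 1 else 0 := by
  have h : mk (oddCoeff k) * mk (fun n => (-1) ^ n * oddCoeff k n) = 1 := by
    rw [mk_oddCoeff, mk_oddCoeff_alternating]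
    linear_combination mk_evenCoeff_sq h2
  funext n
  rw [cauchyProduct_eq_coeff, h, coeff_one]

theorem isEvenOddParts_inverse_zeta (h2 : (2 : k) ≠ 0) :
    IsEvenOddParts (Ring.inverse (zeta k)) (ofValues (parityWeight (evenCoeff k)))
      (ofValues (oddWeight (oddCoeff k))) where
  plus_one := by
    rw [← valM_nil, valM_ofValues _ (by simp)]
    simp [parityWeight, evenCoeff, halfBinom]
  minus_one := by
    rw [← valM_nil, valM_ofValues _ (by simp)]
    simp [oddWeight, oddCoeff, halfBinom]
  plus_even := by
    rw [IsEvenFunctional, bar_ofValues_parityWeight]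
    congr 2
    funext n
    rw [evenCoeff]
    split_ifs with hn
    · simp [hn.neg_one_pow]
    · simp
  minus_odd := by
    rw [IsOddFunctional, bar_ofValues_oddWeight, ofValues_oddWeight_mul, ofValues_oddWeight_mul,
      cauchyProduct_comm (fun n => (-1) ^ n * oddCoeff k n), cauchyProduct_oddCoeff_alternating h2,
      ofValues_oddWeight_single]
    exact ⟨rfl, rfl⟩
  eq_mul := by
    rw [inverse_zeta, ofValues_parityWeight_mul, cauchyProduct_evenCoeff_oddCoeff h2]

end Parts

/-! ### Initial values and recurrence of the bivariate Catalan numbers. -/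

section Catalan

theorem bivariateCatalan_zero (n : ℕ) : bivariateCatalan 0 n = n.centralBinom := by
  have h := bivariateCatalan_mul 0 n
  have h' := Nat.choose_mul_factorial_mul_factorial (n := 2 * n) (k := n) (by omega)
  rw [show 2 * n - n = n by omega, ← Nat.centralBinom_eq_two_mul_choose] at h'
  simp only [mul_zero, Nat.factorial_zero, one_mul, zero_add] at h
  have hn := Nat.factorial_pos n
  apply Nat.eq_of_mul_eq_mul_right (Nat.mul_pos hn hn)
  rw [h, ← h']
  ring

theorem bivariateCatalan_succ (m n : ℕ) :
    bivariateCatalan (m + 1) n + bivariateCatalan m (n + 1) = 4 * bivariateCatalan m n := by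
  have h1 := bivariateCatalan_mul (m + 1) n
  have h2 := bivariateCatalan_mul m (n + 1)
  have h3 := bivariateCatalan_mul m n
  have e1 : m + 1 + n = m + n + 1 := by omega
  have e2 : 2 * (m + 1) = 2 * m + 1 + 1 := by omega
  have e3 : 2 * (n + 1) = 2 * n + 1 + 1 := by omega
  rw [e1, e2] at h1
  rw [← add_assoc, e3] at h2
  simp only [Nat.factorial_succ] at h1 h2
  have hpos : 0 < (m + 1) * (n + 1) * ((m + n + 1) *
      (m.factorial * (m + n).factorial * n.factorial)) := by positivity
  apply Nat.eq_of_mul_eq_mul_right hpos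
  zify at h1 h2 h3 ⊢
  linear_combination (n + 1) * h1 + (m + 1) * h2 - 4 * (m + 1) * (n + 1) * (m + n + 1) * h3

end Catalan

/-! ### Recursive enumeration of refinements and the sums over one refined part. -/

section Refinements

/-- Increment the first entry of a list. -/
def incHead : List ℕ → List ℕ
  | [] => []
  | b :: t => (b + 1) :: t

theorem incHead_injective : Function.Injective incHead := by
  intro s t h
  cases s <;> cases t <;> simp_all [incHead]

/-- The refinements of `(a + 1) :: l`, given the set `s` of refinements of `l`. -/
def consRefinements (s : Finset (List ℕ)) : ℕ → Finset (List ℕ)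
  | 0 => s.image (1 :: ·)
  | a + 1 => (consRefinements s a).image (1 :: ·) ∪ (consRefinements s a).image incHead

/-- The refinements of a list of positive integers. -/
def refinements : List ℕ → Finset (List ℕ)
  | [] => {[]}
  | a :: l => consRefinements (refinements l) (a - 1)

/-- The number `x` is the sum of an initial segment of the list. -/
def IsPartialSum : List ℕ → ℕ → Prop
  | [], x => x = 0
  | a :: l, x => x = 0 ∨ ∃ y, x = a + y ∧ IsPartialSum l y

theorem isPartialSum_cons {a : ℕ} {l : List ℕ} {x : ℕ} :
    IsPartialSum (a :: l) x ↔ x = 0 ∨ ∃ y, x = a + y ∧ IsPartialSum l y := Iff.rfl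

theorem isPartialSum_zero (l : List ℕ) : IsPartialSum l 0 := by
  cases l with
  | nil => rfl
  | cons a l => exact Or.inl rfl

theorem isPartialSum_iff_take {l : List ℕ} {x : ℕ} :
    IsPartialSum l x ↔ ∃ i ≤ l.length, (l.take i).sum = x := by
  induction l generalizing x with
  | nil => simp [IsPartialSum, eq_comm]
  | cons a l ih =>
    rw [isPartialSum_cons]
    constructor
    · rintro (rfl | ⟨y, rfl, hy⟩)
      · exact ⟨0, by simp⟩
      · obtain ⟨i, hi, rfl⟩ := ih.1 hy
        exact ⟨i + 1, by simpa using hi, by simp⟩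
    · rintro ⟨_ | i, hi, rfl⟩
      · simp
      · exact Or.inr ⟨_, by simp, ih.2 ⟨i, by simpa using hi, rfl⟩⟩

theorem mem_boundaries_iff {n : ℕ} (α : Composition n) (x : Fin (n + 1)) :
    x ∈ α.boundaries ↔ IsPartialSum α.blocks x := by
  rw [isPartialSum_iff_take, Composition.boundaries]
  simp only [Finset.mem_map, Finset.mem_univ, true_and]
  constructor
  · rintro ⟨i, rfl⟩
    exact ⟨i, Nat.lt_succ_iff.1 i.2, rfl⟩
  · rintro ⟨i, hi, h⟩
    exact ⟨⟨i, Nat.lt_succ_of_le hi⟩, Fin.ext h⟩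

/-- A refinement of `(a + 2) :: l` has head `1` or a larger head. Deleting the `1`, or lowering the
head by one, leaves a refinement of `(a + 1) :: l`, and both operations are reversible. -/
theorem mem_consRefinements {l : List ℕ} {s : Finset (List ℕ)}
    (hs : ∀ β, β ∈ s ↔ (∀ b ∈ β, 0 < b) ∧ β.sum = l.sum ∧
      ∀ x, IsPartialSum l x → IsPartialSum β x) (a : ℕ) (β : List ℕ) :
    β ∈ consRefinements s a ↔ (∀ b ∈ β, 0 < b) ∧ β.sum = ((a + 1) :: l).sum ∧
      ∀ x, IsPartialSum ((a + 1) :: l) x → IsPartialSum β x := by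
  induction a generalizing β with
  | zero =>
    simp only [consRefinements, Finset.mem_image, hs]
    constructor
    · rintro ⟨β, ⟨hp, hsum, h⟩, rfl⟩
      refine ⟨by simpa using hp, by simp [hsum], ?_⟩
      rintro x (rfl | ⟨y, rfl, hy⟩)
      · exact isPartialSum_zero _
      · exact Or.inr ⟨y, by omega, h y hy⟩
    · rintro ⟨hp, hsum, h⟩
      rcases β with _ | ⟨b, t⟩
      · simp at hsum
        omega
      · have hb := hp b (by simp)
        -- Since `1` must be a partial sum of `b :: t`, the head is forced to be `1`.
        rcases h 1 (Or.inr ⟨0, rfl, isPartialSum_zero l⟩) with h1 | ⟨z, hz, -⟩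
        · omega
        have hb1 : b = 1 := by omega
        subst hb1
        refine ⟨t, ⟨fun c hc => hp c (List.mem_cons_of_mem _ hc), by simpa using hsum, ?_⟩, rfl⟩
        intro y hy
        rcases h (1 + y) (Or.inr ⟨y, by omega, hy⟩) with h1 | ⟨z, hz, h2⟩
        · omega
        · rwa [show y = z by omega]
  | succ a ih =>
    simp only [consRefinements, Finset.mem_union, Finset.mem_image, ih]
    constructor
    · rintro (⟨β, ⟨hp, hsum, h⟩, rfl⟩ | ⟨β, ⟨hp, hsum, h⟩, rfl⟩)
      · refine ⟨by simpa using hp, by simp [hsum]; ring, ?_⟩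
        rintro x (rfl | ⟨y, rfl, hy⟩)
        · exact isPartialSum_zero _
        · exact Or.inr ⟨a + 1 + y, by omega, h _ (Or.inr ⟨y, rfl, hy⟩)⟩
      · rcases β with _ | ⟨b, t⟩
        · simp at hsum
          omega
        refine ⟨?_, ?_, ?_⟩
        · intro c hc
          rcases List.mem_cons.1 hc with rfl | hc
          · omega
          · exact hp c (List.mem_cons_of_mem _ hc)
        · simp only [incHead, List.sum_cons] at hsum ⊢
          omega
        · rintro x (rfl | ⟨y, rfl, hy⟩)
          · exact isPartialSum_zero _
          · rcases h (a + 1 + y) (Or.inr ⟨y, rfl, hy⟩) with h1 | ⟨z, hz, h2⟩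
            · omega
            · exact Or.inr ⟨z, by omega, h2⟩
    · rintro ⟨hp, hsum, h⟩
      rcases β with _ | ⟨b, t⟩
      · simp at hsum
        omega
      have hb := hp b (by simp)
      have ht : ∀ c ∈ t, 0 < c := fun c hc => hp c (List.mem_cons_of_mem _ hc)
      simp only [List.sum_cons] at hsum
      by_cases hb1 : b = 1
      · subst hb1
        refine Or.inl ⟨t, ⟨ht, by simp only [List.sum_cons]; omega, ?_⟩, rfl⟩
        rintro x (rfl | ⟨y, rfl, hy⟩)
        · exact isPartialSum_zero _
        · rcases h (a + 1 + 1 + y) (Or.inr ⟨y, rfl, hy⟩) with h1 | ⟨z, hz, h2⟩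
          · omega
          · rwa [show a + 1 + y = z by omega]
      · obtain ⟨c, rfl⟩ : ∃ c, b = c + 2 := ⟨b - 2, by omega⟩
        refine Or.inr ⟨(c + 1) :: t, ⟨?_, by simp only [List.sum_cons]; omega, ?_⟩, rfl⟩
        · intro d hd
          rcases List.mem_cons.1 hd with rfl | hd
          · omega
          · exact ht d hd
        · rintro x (rfl | ⟨y, rfl, hy⟩)
          · exact isPartialSum_zero _
          · rcases h (a + 1 + 1 + y) (Or.inr ⟨y, rfl, hy⟩) with h1 | ⟨z, hz, h2⟩
            · omega
            · exact Or.inr ⟨z, by omega, h2⟩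

theorem mem_refinements {α : List ℕ} (hα : ∀ a ∈ α, 0 < a) (β : List ℕ) :
    β ∈ refinements α ↔ (∀ b ∈ β, 0 < b) ∧ β.sum = α.sum ∧
      ∀ x, IsPartialSum α x → IsPartialSum β x := by
  induction α generalizing β with
  | nil =>
    simp only [refinements, Finset.mem_singleton, List.sum_nil]
    constructor
    · rintro rfl
      simp
    · rintro ⟨hp, hsum, -⟩
      rcases β with _ | ⟨b, t⟩
      · rfl
      · have hb := hp b (by simp)
        simp only [List.sum_cons] at hsum
        omega
  | cons a l ih =>
    have ha := hα a (by simp)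
    rw [refinements, mem_consRefinements (ih fun c hc => hα c (List.mem_cons_of_mem _ hc)),
      Nat.sub_add_cancel ha]

variable {k : Type*} [Field k]

theorem functional_F (φ : Functional k) {n : ℕ} (α : Composition n) :
    φ.ofConv (F k α) = ∑ β ∈ refinements α.blocks, valM φ β := by
  rw [F, map_sum]
  have hα : ∀ a ∈ α.blocks, 0 < a := fun a ha => α.blocks_pos ha
  refine Finset.sum_bij (fun β _ => β.blocks) ?_ ?_ ?_ ?_
  · intro β hβ
    rw [Finset.mem_filter] at hβ
    rw [mem_refinements hα]
    refine ⟨fun a ha => β.blocks_pos ha, by rw [β.blocks_sum, α.blocks_sum], fun x hx => ?_⟩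
    obtain ⟨i, hi, hix⟩ := isPartialSum_iff_take.1 hx
    have hxn : x < n + 1 := by
      rw [← hix]
      exact Nat.lt_succ_of_le (α.sizeUpTo_le i)
    exact (mem_boundaries_iff β ⟨x, hxn⟩).1 (hβ.2 ((mem_boundaries_iff α ⟨x, hxn⟩).2 hx))
  · intro β _ γ _ h
    exact Composition.ext h
  · intro l hl
    rw [mem_refinements hα] at hl
    refine ⟨⟨l, fun {i} hi => hl.1 i hi, hl.2.1.trans α.blocks_sum⟩, ?_, rfl⟩
    rw [Finset.mem_filter]
    refine ⟨Finset.mem_univ _, fun x hx => ?_⟩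
    rw [mem_boundaries_iff] at hx ⊢
    exact hl.2.2 _ hx
  · intro β _
    rfl

theorem exists_cons_of_mem_consRefinements {s : Finset (List ℕ)} {a : ℕ} {β : List ℕ}
    (h : β ∈ consRefinements s a) : ∃ b t, β = (b + 1) :: t := by
  induction a generalizing β with
  | zero =>
    obtain ⟨β, -, rfl⟩ := Finset.mem_image.1 h
    exact ⟨0, β, rfl⟩
  | succ a ih =>
    rcases Finset.mem_union.1 h with h | h
    · obtain ⟨β, -, rfl⟩ := Finset.mem_image.1 h
      exact ⟨0, β, rfl⟩
    · obtain ⟨β, hβ, rfl⟩ := Finset.mem_image.1 h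
      obtain ⟨b, t, rfl⟩ := ih hβ
      exact ⟨b + 1, t, rfl⟩

theorem sum_consRefinements_zero (s : Finset (List ℕ)) (w : List ℕ → k) :
    ∑ β ∈ consRefinements s 0, w β = ∑ β ∈ s, w (1 :: β) := by
  rw [consRefinements, Finset.sum_image]
  exact fun _ _ _ _ h => (List.cons.inj h).2

theorem sum_consRefinements_succ (s : Finset (List ℕ)) (w : List ℕ → k) (a : ℕ) :
    ∑ β ∈ consRefinements s (a + 1), w β =
      (∑ β ∈ consRefinements s a, w (1 :: β)) + ∑ β ∈ consRefinements s a, w (incHead β) := by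
  rw [consRefinements, Finset.sum_union, Finset.sum_image, Finset.sum_image]
  · exact fun _ _ _ _ h => incHead_injective h
  · exact fun _ _ _ _ h => (List.cons.inj h).2
  · rw [Finset.disjoint_left]
    intro β h h'
    obtain ⟨γ, -, rfl⟩ := Finset.mem_image.1 h
    obtain ⟨δ, hδ, e⟩ := Finset.mem_image.1 h'
    obtain ⟨b, t, rfl⟩ := exists_cons_of_mem_consRefinements hδ
    simp [incHead] at e

/-- The weight of the tail of a list that starts with an odd entry. -/
def oddTailWeight (c : ℕ → k) : List ℕ → k
  | [] => 0
  | b :: t => if Even b then 0 else parityWeight c t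

/-- The weight of the tail of a list that starts with an even entry. -/
def evenTailWeight (c : ℕ → k) : List ℕ → k
  | [] => 0
  | b :: t => if Even b then parityWeight c t else 0

/-- For odd heads, let `β` run over the refinements for `a`. If its head is even, the weights of `1
:: β` and `incHead β` cancel. If it is odd, only `1 :: β` counts, and the index of `c` moves by one.
Lists with even head arise by `incHead` from those with odd head one step earlier, so both sums
agree. -/
theorem sum_tailWeight (s : Finset (List ℕ)) (c : ℕ → k) (a : ℕ) :
    ∑ β ∈ consRefinements s a, oddTailWeight c β =
        ∑ β ∈ s, parityWeight (fun i => c (i + a)) β ∧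
      ∑ β ∈ consRefinements s (a + 1), evenTailWeight c β =
        ∑ β ∈ s, parityWeight (fun i => c (i + a)) β := by
  have step : ∀ a, ∑ β ∈ consRefinements s (a + 1), evenTailWeight c β =
      ∑ β ∈ consRefinements s a, oddTailWeight c β := by
    intro a
    rw [sum_consRefinements_succ, Finset.sum_eq_zero, zero_add]
    · refine Finset.sum_congr rfl fun β hβ => ?_
      obtain ⟨b, t, rfl⟩ := exists_cons_of_mem_consRefinements hβ
      simp only [incHead, evenTailWeight, oddTailWeight, Nat.even_add_one, ite_not, not_not]
    · intro β _
      simp [evenTailWeight]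
  have odd : ∀ (a : ℕ) (c : ℕ → k), ∑ β ∈ consRefinements s a, oddTailWeight c β =
      ∑ β ∈ s, parityWeight (fun i => c (i + a)) β := by
    intro a
    induction a with
    | zero =>
      intro c
      rw [sum_consRefinements_zero]
      simp [oddTailWeight]
    | succ a ih =>
      intro c
      have h := ih fun i => c (i + 1)
      rw [sum_consRefinements_succ, ← Finset.sum_add_distrib]
      refine Eq.trans ?_ h
      refine Finset.sum_congr rfl fun β hβ => ?_
      obtain ⟨b, t, rfl⟩ := exists_cons_of_mem_consRefinements hβ
      simp only [incHead, oddTailWeight, parityWeight_cons]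
      by_cases hb : Even b <;> simp [hb, Nat.even_add_one]
  exact ⟨odd a c, (step a).trans (odd a c)⟩

end Refinements

/-! ### Closed forms for the sums over all refinements. -/

section Evaluation

variable {k : Type*} [Field k]

/-- The coefficientwise difference `c_(i+2) - c_i`. -/
def secondShiftSub (c : ℕ → k) (i : ℕ) : k := c (i + 2) - c i

theorem secondShiftSub_iterate_shift (p : ℕ) (c : ℕ → k) (b : ℕ) :
    secondShiftSub^[p] (fun i => c (i + b)) = fun i => (secondShiftSub^[p] c) (i + b) := by
  induction p generalizing c with
  | zero => rfl
  | succ p ih =>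
    rw [Function.iterate_succ_apply, Function.iterate_succ_apply, ← ih]
    congr 1
    funext i
    simp only [secondShiftSub, add_right_comm i b 2]

/-- This keeps the natural subtraction in `l.sum - 2 * l.countP (1 < ·)` from truncating. -/
theorem two_mul_countP_le_sum (l : List ℕ) : 2 * l.countP (1 < ·) ≤ l.sum := by
  induction l with
  | nil => simp
  | cons a l ih =>
    rw [List.countP_cons, List.sum_cons]
    split_ifs with h
    · simp only [decide_eq_true_eq] at h
      omega
    · omega

theorem sum_oddWeight_cons (c : ℕ → k) {a : ℕ} (ha : 0 < a) (l : List ℕ) :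
    ∑ β ∈ refinements (a :: l), oddWeight c β =
      ∑ β ∈ refinements l, parityWeight (fun i => c (i + a)) β := by
  obtain ⟨a, rfl⟩ : ∃ b, a = b + 1 := ⟨a - 1, by omega⟩
  have h := (sum_tailWeight (refinements l) (fun i => c (i + 1)) a).1
  simp only [add_assoc] at h
  rw [refinements, Nat.add_sub_cancel, ← h]
  refine Finset.sum_congr rfl fun β hβ => ?_
  obtain ⟨b, t, rfl⟩ := exists_cons_of_mem_consRefinements hβ
  rfl

/-- Odd heads add `c` shifted by `a`, and even heads subtract `c` shifted by `a - 2`. For `a = 1` no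
head is even. -/
theorem sum_parityWeight_cons (c : ℕ → k) {a : ℕ} (ha : 0 < a) (l : List ℕ) :
    ∑ β ∈ refinements (a :: l), parityWeight c β =
      if 1 < a then ∑ β ∈ refinements l, parityWeight (fun i => secondShiftSub c (i + (a - 2))) β
      else ∑ β ∈ refinements l, parityWeight (fun i => c (i + a)) β := by
  have split : ∑ β ∈ refinements (a :: l), parityWeight c β =
      ∑ β ∈ refinements (a :: l), oddWeight c β -
        ∑ β ∈ refinements (a :: l), evenTailWeight c β := by
    rw [← Finset.sum_sub_distrib]
    refine Finset.sum_congr rfl fun β hβ => ?_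
    obtain ⟨b, t, rfl⟩ := exists_cons_of_mem_consRefinements hβ
    simp only [parityWeight_cons, oddWeight_cons, evenTailWeight]
    split_ifs <;> simp
  rw [split, sum_oddWeight_cons c ha]
  split_ifs with h1
  · obtain ⟨b, rfl⟩ : ∃ b, a = b + 2 := ⟨a - 2, by omega⟩
    rw [refinements, show b + 2 - 1 = b + 1 by omega, (sum_tailWeight _ c b).2,
      Nat.add_sub_cancel, ← Finset.sum_sub_distrib]
    refine Finset.sum_congr rfl fun β _ => ?_
    have h := parityWeight_linear (-1) (fun i => c (i + b)) (fun i => c (i + (b + 2))) β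
    rw [show (fun i => secondShiftSub c (i + b)) =
      fun i => -1 * c (i + b) + c (i + (b + 2)) by
        funext i; rw [secondShiftSub, ← add_assoc]; ring, h]
    ring
  · obtain rfl : a = 1 := by omega
    rw [refinements, sum_consRefinements_zero]
    simp [evenTailWeight]

theorem sum_parityWeight (c : ℕ → k) {l : List ℕ} (hl : ∀ a ∈ l, 0 < a) :
    ∑ β ∈ refinements l, parityWeight c β =
      (secondShiftSub^[l.countP (1 < ·)] c) (l.sum - 2 * l.countP (1 < ·)) := by
  induction l generalizing c with
  | nil => simp [refinements, parityWeight]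
  | cons a l ih =>
    have hl' := fun b hb => hl b (List.mem_cons_of_mem a hb)
    have hc := two_mul_countP_le_sum l
    rw [sum_parityWeight_cons c (hl a (by simp)), List.countP_cons, List.sum_cons]
    simp only [decide_eq_true_eq]
    split_ifs with h1
    · rw [ih _ hl', secondShiftSub_iterate_shift, Function.iterate_succ_apply]
      exact congrArg _ (by omega)
    · rw [ih _ hl', secondShiftSub_iterate_shift, add_zero]
      exact congrArg _ (by omega)

/-- Even heads have weight zero, so the first part contributes a pure shift. This is why only the
tail is counted. -/
theorem sum_oddWeight (c : ℕ → k) {l : List ℕ} (hl : ∀ a ∈ l, 0 < a) :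
    ∑ β ∈ refinements l, oddWeight c β =
      (secondShiftSub^[l.tail.countP (1 < ·)] c) (l.sum - 2 * l.tail.countP (1 < ·)) := by
  cases l with
  | nil => simp [refinements, oddWeight]
  | cons a l =>
    have hc := two_mul_countP_le_sum l
    rw [sum_oddWeight_cons c (hl a (by simp)),
      sum_parityWeight _ fun b hb => hl b (List.mem_cons_of_mem a hb),
      secondShiftSub_iterate_shift, List.tail_cons, List.sum_cons]
    exact congrArg _ (by omega)

/-- Over the common denominator the difference is `C(p, q+1) - 4 C(p, q) = -C(p+1, q)` with `q = m /
2`; the minus sign accounts for `(-1)^p`. -/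
theorem secondShiftSub_iterate_oddCoeff (h2 : (2 : k) ≠ 0) (p m : ℕ) :
    (secondShiftSub^[p] (oddCoeff k)) m =
      (-1) ^ (m + p) * (bivariateCatalan p (m / 2) : k) / 4 ^ (p + m / 2) := by
  have h4 : (4 : k) ≠ 0 := by
    rw [show (4 : k) = 2 * 2 by norm_num]
    exact mul_ne_zero h2 h2
  induction p generalizing m with
  | zero => simp [oddCoeff, halfBinom, bivariateCatalan_zero, mul_div_assoc]
  | succ p ih =>
    rw [Function.iterate_succ_apply', secondShiftSub, ih, ih,
      show (m + 2) / 2 = m / 2 + 1 by omega]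
    have h := congrArg (Nat.cast : ℕ → k) (bivariateCatalan_succ p (m / 2))
    push_cast at h
    rw [show p + 1 + m / 2 = p + m / 2 + 1 by omega, ← add_assoc, pow_succ (4 : k)]
    field_simp
    ring_nf at h ⊢
    linear_combination ((-1) ^ m * (-1) ^ p : k) * h

theorem secondShiftSub_iterate_evenCoeff (p m : ℕ) :
    (secondShiftSub^[p] (evenCoeff k)) m =
      if Even m then (secondShiftSub^[p] (oddCoeff k)) m else 0 := by
  induction p generalizing m with
  | zero =>
    simp only [Function.iterate_zero, id_eq, evenCoeff, oddCoeff]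
    split_ifs with h
    · rw [h.neg_one_pow, one_mul]
    · rfl
  | succ p ih =>
    rw [Function.iterate_succ_apply', Function.iterate_succ_apply', secondShiftSub,
      secondShiftSub, ih, ih]
    simp only [Nat.even_add, even_two, iff_true]
    split_ifs <;> simp

end Evaluation

/-! ### The statistics `p₋` and `p₊` in terms of partial sums. -/

section Statistics

theorem card_filter_ne_last (l : List ℕ) :
    Finset.card {i : Fin l.length | (i : ℕ) + 1 ≠ l.length ∧ 1 < l.get i} =
      l.dropLast.countP (1 < ·) := by
  induction l with
  | nil => simp
  | cons a l ih =>
    have h := Fin.card_filter_univ_succ' fun i : Fin (l.length + 1) =>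
      (i : ℕ) + 1 ≠ (a :: l).length ∧ 1 < (a :: l).get i
    refine h.trans ?_
    simp only [Fin.val_succ, List.length_cons, ne_eq, add_left_inj, Fin.val_zero,
      List.get_eq_getElem, List.getElem_cons_zero, List.getElem_cons_succ]
    simp only [ne_eq, List.get_eq_getElem] at ih
    rw [ih]
    cases l with
    | nil => simp
    | cons b l =>
      rw [List.dropLast_cons_cons, List.countP_cons]
      simp [add_comm]

theorem peakMinus_eq_countP {n : ℕ} (α : Composition n) :
    peakMinus α = α.blocks.dropLast.countP (1 < ·) :=
  card_filter_ne_last α.blocks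

theorem peakPlus_eq_countP {n : ℕ} (α : Composition n) :
    peakPlus α =
      if 1 < α.blocks.length then 1 + α.blocks.tail.dropLast.countP (1 < ·) else 0 := by
  have key : ∀ l : List ℕ, Finset.card {i : Fin l.length |
      (i : ℕ) ≠ 0 ∧ (i : ℕ) + 1 ≠ l.length ∧ 1 < l.get i} = l.tail.dropLast.countP (1 < ·) := by
    intro l
    cases l with
    | nil => simp
    | cons a l =>
      have h := Fin.card_filter_univ_succ' fun i : Fin (l.length + 1) =>
        (i : ℕ) ≠ 0 ∧ (i : ℕ) + 1 ≠ (a :: l).length ∧ 1 < (a :: l).get i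
      refine h.trans ?_
      rw [List.tail_cons, ← card_filter_ne_last l]
      simp
  rw [← key α.blocks]
  rfl

theorem isPartialSum_cons_add {a : ℕ} (ha : 0 < a) (l : List ℕ) (j : ℕ) :
    IsPartialSum (a :: l) (a + j) ↔ IsPartialSum l j := by
  rw [isPartialSum_cons]
  constructor
  · rintro (h | ⟨y, hy, h⟩)
    · omega
    · rwa [show j = y by omega]
  · exact fun h => Or.inr ⟨j, rfl, h⟩

theorem isPartialSum_cons_of_lt {a : ℕ} (l : List ℕ) {j : ℕ} (hj : j < a) :
    IsPartialSum (a :: l) j ↔ j = 0 := by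
  rw [isPartialSum_cons]
  constructor
  · rintro (h | ⟨y, hy, -⟩)
    · exact h
    · omega
  · exact Or.inl

theorem isPartialSum_sum (l : List ℕ) : IsPartialSum l l.sum :=
  isPartialSum_iff_take.2 ⟨l.length, le_rfl, by simp⟩

theorem card_filter_range_add (p : ℕ → Prop) [DecidablePred p] (a b : ℕ) :
    Finset.card {i ∈ Finset.range (a + b) | p i} =
      Finset.card {i ∈ Finset.range a | p i} + Finset.card {i ∈ Finset.range b | p (a + i)} := by
  simp only [Finset.card_filter]
  exact Finset.sum_range_add _ a b

theorem card_filter_range_succ' (p : ℕ → Prop) [DecidablePred p] (b : ℕ) :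
    Finset.card {i ∈ Finset.range (b + 1) | p i} =
      Finset.card {i ∈ Finset.range b | p (i + 1)} + if p 0 then 1 else 0 := by
  simp only [Finset.card_filter]
  exact Finset.sum_range_succ' _ b

open scoped Classical in
/-- The entries greater than `1` are counted by the partial sums whose predecessor is none. -/
theorem countP_eq_card {l : List ℕ} (hl : ∀ a ∈ l, 0 < a) :
    l.countP (1 < ·) = Finset.card
      {i ∈ Finset.range l.sum | ¬IsPartialSum l i ∧ IsPartialSum l (i + 1)} := by
  induction l with
  | nil => simp
  | cons a l ih =>
    have ha := hl a (by simp)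
    rw [List.countP_cons, List.sum_cons, card_filter_range_add,
      ih fun b hb => hl b (List.mem_cons_of_mem a hb)]
    simp only [add_assoc, isPartialSum_cons_add ha]
    rw [add_comm]
    congr 1
    obtain ⟨b, rfl⟩ : ∃ b, a = b + 1 := ⟨a - 1, by omega⟩
    rw [Finset.card_filter, Finset.sum_range_succ, Finset.sum_eq_zero, zero_add]
    · have h := isPartialSum_cons_add ha l 0
      rw [add_zero] at h
      rw [h, isPartialSum_cons_of_lt l (Nat.lt_succ_self b)]
      simp [isPartialSum_zero, Nat.pos_iff_ne_zero]
    · intro i hi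
      rw [Finset.mem_range] at hi
      rw [isPartialSum_cons_of_lt l (show i + 1 < b + 1 by omega)]
      simp

-- A part greater than `1` is detected by the partial sum at its end. The range stops before
-- `l.sum`, which omits the last part, and `i = 0` is excluded because `0 - 1 = 0` is a partial sum.
open scoped Classical in
theorem countP_dropLast_eq_card {l : List ℕ} (hl : ∀ a ∈ l, 0 < a) :
    l.dropLast.countP (1 < ·) = Finset.card
      {i ∈ Finset.range l.sum | IsPartialSum l i ∧ ¬IsPartialSum l (i - 1)} := by
  induction l with
  | nil => simp
  | cons a l ih =>
    have ha := hl a (by simp)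
    have hl' := fun b hb => hl b (List.mem_cons_of_mem a hb)
    have h0 : Finset.card {i ∈ Finset.range a |
        IsPartialSum (a :: l) i ∧ ¬IsPartialSum (a :: l) (i - 1)} = 0 := by
      rw [Finset.card_eq_zero, Finset.filter_eq_empty_iff]
      rintro i hi ⟨h1, h2⟩
      rw [Finset.mem_range] at hi
      rw [isPartialSum_cons_of_lt l hi] at h1
      exact h2 (by rw [h1]; exact isPartialSum_zero _)
    rw [List.sum_cons, card_filter_range_add, h0, zero_add]
    cases l with
    | nil => simp
    | cons b l =>
      have hb := hl' b (by simp)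
      have ih := ih hl'
      obtain ⟨s, hs⟩ : ∃ s, (b :: l).sum = s + 1 :=
        ⟨b - 1 + l.sum, by rw [List.sum_cons]; omega⟩
      rw [List.dropLast_cons_cons, List.countP_cons, ih, hs, card_filter_range_succ',
        card_filter_range_succ']
      simp only [isPartialSum_cons_add ha, isPartialSum_zero, add_zero, Nat.add_sub_cancel,
        Nat.zero_sub, not_true_eq_false, and_false, if_false]
      congr 1
      · congr 1
        refine Finset.filter_congr fun i _ => ?_
        rw [show a + (i + 1) - 1 = a + i by omega, isPartialSum_cons_add ha]
      · rw [isPartialSum_cons_of_lt _ (show a - 1 < a by omega)]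
        simp only [decide_eq_true_eq]
        congr 1
        have haa := (isPartialSum_cons_add ha (b :: l) 0).2 (isPartialSum_zero _)
        rw [add_zero] at haa
        exact propext ⟨fun h => ⟨haa, by omega⟩, fun h => by have := h.2; omega⟩

-- The end of the first part is always counted when there is a second one: either its predecessor is
-- no partial sum, or it equals `1`. This is the summand `1` in `p₊`.
open scoped Classical in
theorem peakPlus_eq_card {n : ℕ} (γ : Composition n) :
    peakPlus γ = Finset.card {i ∈ Finset.range n | IsPartialSum γ.blocks i ∧ 0 < i ∧
      (¬IsPartialSum γ.blocks (i - 1) ∨ i = 1)} := by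
  have hpos : ∀ a ∈ γ.blocks, 0 < a := fun a ha => γ.blocks_pos ha
  rw [peakPlus_eq_countP]
  have hs := γ.blocks_sum
  generalize γ.blocks = l at hpos hs ⊢
  subst hs
  cases l with
  | nil => simp
  | cons a l =>
    have ha := hpos a (by simp)
    have hl := fun b hb => hpos b (List.mem_cons_of_mem a hb)
    have h0 : Finset.card {i ∈ Finset.range a | IsPartialSum (a :: l) i ∧ 0 < i ∧
        (¬IsPartialSum (a :: l) (i - 1) ∨ i = 1)} = 0 := by
      rw [Finset.card_eq_zero, Finset.filter_eq_empty_iff]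
      rintro i hi ⟨h1, h2, -⟩
      rw [Finset.mem_range] at hi
      rw [isPartialSum_cons_of_lt l hi] at h1
      omega
    rw [List.sum_cons, card_filter_range_add, h0, zero_add]
    cases l with
    | nil => simp
    | cons b l =>
      have hb := hl b (by simp)
      obtain ⟨s, hs⟩ : ∃ s, (b :: l).sum = s + 1 :=
        ⟨b - 1 + l.sum, by rw [List.sum_cons]; omega⟩
      rw [if_pos (by simp), List.tail_cons, countP_dropLast_eq_card hl, hs,
        card_filter_range_succ', card_filter_range_succ', add_comm]
      have hp0 : IsPartialSum (a :: b :: l) (a + 0) ∧ 0 < a + 0 ∧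
          (¬IsPartialSum (a :: b :: l) (a + 0 - 1) ∨ a + 0 = 1) := by
        refine ⟨(isPartialSum_cons_add ha _ 0).2 (isPartialSum_zero _), ha, ?_⟩
        rw [add_zero, isPartialSum_cons_of_lt _ (show a - 1 < a by omega)]
        omega
      rw [if_pos hp0, if_neg fun h => h.2 (isPartialSum_zero _), add_zero]
      congr 2
      refine Finset.filter_congr fun i _ => ?_
      rw [show a + (i + 1) - 1 = a + i by omega, isPartialSum_cons_add ha,
        isPartialSum_cons_add ha, Nat.add_sub_cancel]
      have h1 : a + (i + 1) ≠ 1 := by omega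
      have h2 : 0 < a + (i + 1) := by omega
      simp [h1, h2]

theorem isPartialSum_conjugate {n : ℕ} (α : Composition n) {x : ℕ} (hx : x ≤ n) :
    IsPartialSum (conjugate α).blocks x ↔
      x = 0 ∨ x = n ∨ ¬IsPartialSum α.blocks (n - x) := by
  have h := mem_boundaries_iff (conjugate α) ⟨x, Nat.lt_succ_of_le hx⟩
  rw [← h, conjugate, CompositionAsSet.toComposition_boundaries]
  simp only [Finset.mem_filter, Finset.mem_univ, true_and, mem_boundaries_iff, Fin.ext_iff,
    Fin.val_rev, Fin.val_zero, Fin.val_last]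
  rw [Nat.add_sub_add_right]

/-- The statistic `p₊` of the conjugate counts the parts greater than `1`. -/
theorem peakPlus_conjugate {n : ℕ} (α : Composition n) :
    peakPlus (conjugate α) = α.blocks.countP (1 < ·) := by
  classical
  have hn : IsPartialSum α.blocks n := by
    have h := isPartialSum_sum α.blocks
    rwa [α.blocks_sum] at h
  have h0 := isPartialSum_zero α.blocks
  rw [peakPlus_eq_card, countP_eq_card fun a ha => α.blocks_pos ha, α.blocks_sum]
  -- Reflection exchanges interior partial sums of the conjugate with interior non-sums of `α`, so
  -- the two conditions on `i` and `i - 1` become those on `n - i` and `n - i + 1`. The exceptional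
  -- case `i = 1` matches `n`, which is always a partial sum of `α`.
  refine Finset.card_nbij' (fun i => n - i) (fun i => n - i) ?_ ?_ ?_ ?_
  · intro i hi
    simp only [Finset.coe_filter, Finset.mem_range, Set.mem_ofPred_eq] at hi ⊢
    obtain ⟨hin, h1, h2, h3⟩ := hi
    rw [isPartialSum_conjugate α hin.le] at h1
    refine ⟨by omega, ?_, ?_⟩
    · rcases h1 with h | h | h
      · omega
      · omega
      · exact h
    · by_cases hi1 : i = 1
      · rwa [hi1, show n - 1 + 1 = n by omega]
      · have h3 := h3.resolve_right hi1
        rw [isPartialSum_conjugate α (by omega)] at h3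
        push Not at h3
        rw [show n - i + 1 = n - (i - 1) by omega]
        exact h3.2.2
  · intro i hi
    simp only [Finset.coe_filter, Finset.mem_range, Set.mem_ofPred_eq] at hi ⊢
    obtain ⟨hin, h1, h2⟩ := hi
    have hi0 : i ≠ 0 := by
      rintro rfl
      exact h1 h0
    refine ⟨by omega, ?_, by omega, ?_⟩
    · rw [isPartialSum_conjugate α (by omega), show n - (n - i) = i by omega]
      exact Or.inr (Or.inr h1)
    · by_cases hi1 : n - i = 1
      · exact Or.inr hi1
      · refine Or.inl ?_
        rw [isPartialSum_conjugate α (by omega), show n - (n - i - 1) = i + 1 by omega]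
        push Not
        exact ⟨by omega, by omega, h2⟩
  · intro i hi
    simp only [Finset.coe_filter, Finset.mem_range, Set.mem_ofPred_eq] at hi
    change n - (n - i) = i
    omega
  · intro i hi
    simp only [Finset.coe_filter, Finset.mem_range, Set.mem_ofPred_eq] at hi
    change n - (n - i) = i
    omega

theorem peakMinus_reverse {n : ℕ} (α : Composition n) :
    peakMinus α.reverse = α.blocks.tail.countP (1 < ·) := by
  rw [peakMinus_eq_countP]
  change α.blocks.reverse.dropLast.countP _ = _
  rw [List.dropLast_reverse, List.countP_reverse]

end Statistics

end QuasiSym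

/-! ### The theorem. -/

theorem theoremT (k : Type*) [Field k] (hk : ringChar k ≠ 2) :
    IsUnit (QuasiSym.zeta k) ∧
    (∃! p : QuasiSym.Functional k × QuasiSym.Functional k,
      QuasiSym.IsEvenOddParts (Ring.inverse (QuasiSym.zeta k)) p.1 p.2) ∧
    ∀ zetaInvPlus zetaInvMinus : QuasiSym.Functional k,
      QuasiSym.IsEvenOddParts (Ring.inverse (QuasiSym.zeta k)) zetaInvPlus zetaInvMinus →
      ∀ (n : ℕ) (α : Composition n),
        zetaInvMinus.ofConv (QuasiSym.F k α) =
          (-1) ^ (n + QuasiSym.peakMinus α.reverse) / 2 ^ (2 * (n / 2)) *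
            (QuasiSym.bivariateCatalan (QuasiSym.peakMinus α.reverse)
              (n / 2 - QuasiSym.peakMinus α.reverse) : k) ∧
        zetaInvPlus.ofConv (QuasiSym.F k α) =
          if Even n then
            (-1) ^ QuasiSym.peakPlus (QuasiSym.conjugate α) / 2 ^ n *
              (QuasiSym.bivariateCatalan (QuasiSym.peakPlus (QuasiSym.conjugate α))
                (n / 2 - QuasiSym.peakPlus (QuasiSym.conjugate α)) : k)
          else 0 := by
  have h2 : (2 : k) ≠ 0 := Ring.two_ne_zero hk
  have hparts := QuasiSym.isEvenOddParts_inverse_zeta h2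
  have hunit : IsUnit (Ring.inverse (QuasiSym.zeta k)) := QuasiSym.isUnit_zeta.ringInverse
  refine ⟨QuasiSym.isUnit_zeta, ⟨(_, _), hparts, ?_⟩, ?_⟩
  · rintro ⟨ρ, ψ⟩ h
    exact Prod.ext_iff.2 (h.unique h2 hunit hparts)
  · intro ρ ψ h n α
    obtain ⟨rfl, rfl⟩ := h.unique h2 hunit hparts
    have hpos : ∀ a ∈ α.blocks, 0 < a := fun a ha => α.blocks_pos ha
    have hmem : ∀ β ∈ QuasiSym.refinements α.blocks, ∀ b ∈ β, 0 < b := fun β hβ =>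
      ((QuasiSym.mem_refinements hpos β).1 hβ).1
    have hsum := α.blocks_sum
    have h4 : (4 : k) = 2 ^ 2 := by norm_num
    constructor
    · rw [QuasiSym.functional_F,
        Finset.sum_congr rfl fun β hβ => QuasiSym.valM_ofValues _ (hmem β hβ),
        QuasiSym.sum_oddWeight _ hpos, QuasiSym.peakMinus_reverse, hsum,
        QuasiSym.secondShiftSub_iterate_oddCoeff h2]
      have hq : 2 * α.blocks.tail.countP (1 < ·) ≤ n := by
        have := QuasiSym.two_mul_countP_le_sum α.blocks.tail
        have := (List.tail_sublist α.blocks).sum_le_sum (by simp)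
        omega
      generalize α.blocks.tail.countP (1 < ·) = q at hq ⊢
      -- Writing `n = 2q + m` removes the truncated subtractions: `n - 2q = m` and `n / 2 - q = m /
      -- 2`.
      obtain ⟨m, rfl⟩ := Nat.exists_eq_add_of_le hq
      rw [show 2 * q + m - 2 * q = m by omega, show (2 * q + m) / 2 = q + m / 2 by omega,
        Nat.add_sub_cancel_left, pow_mul, ← h4, add_assoc, pow_add (-1 : k) (2 * q), pow_mul]
      ring
    · rw [QuasiSym.functional_F,
        Finset.sum_congr rfl fun β hβ => QuasiSym.valM_ofValues _ (hmem β hβ),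
        QuasiSym.sum_parityWeight _ hpos, QuasiSym.peakPlus_conjugate, hsum,
        QuasiSym.secondShiftSub_iterate_evenCoeff, QuasiSym.secondShiftSub_iterate_oddCoeff h2]
      have hq : 2 * α.blocks.countP (1 < ·) ≤ n := by
        have := QuasiSym.two_mul_countP_le_sum α.blocks
        omega
      generalize α.blocks.countP (1 < ·) = q at hq ⊢
      obtain ⟨m, rfl⟩ := Nat.exists_eq_add_of_le hq
      rw [show 2 * q + m - 2 * q = m by omega, show (2 * q + m) / 2 = q + m / 2 by omega,
        Nat.add_sub_cancel_left]
      simp only [Nat.even_add, even_two_mul, true_iff]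
      split_ifs with hm
      -- For even `m` the sign `(-1)^(m + q)` reduces to `(-1)^q`, and `4^(q + m / 2)` equals `2^n`.
      · obtain ⟨j, rfl⟩ := hm
        rw [show (j + j) / 2 = j by omega, show 2 * q + (j + j) = 2 * (q + j) by omega, pow_mul,
          ← h4, pow_add (-1 : k) (j + j), Even.neg_one_pow ⟨j, rfl⟩]
        ring
      · rfl
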